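/- Let $n\ge 1$ and let $p_1,\dots,p_n\in[0,1)$ with $\lambda:=\sum_{i=1}^n p_i>0$. For each $i$ let $Q_i$ be a probability distribution on $\mathbb N=\{1,2,\dots\}$ with finite mean $q_i$. Let $Y_i=B_iX_i$, $i=1,\dots,n$, be independent random variables, where $B_i\sim\mathrm{Bern}(p_i)$ and $X_i\sim Q_i$ are independent for each $i$, and let $P$ be the distribution of $S=\sum_{i=1}^n Y_i$ (distributions on $\mathbb Z_+=\{0,1,2,\dots\}$ are identified with their probability mass functions). Put $$Q=\sum_{i=1}^n\frac{p_i}{\lambda}Q_i,\qquad q=\frac1\lambda\sum_{i=1}^n p_iq_i .$$ Then $$d_{TV}\big(P,\mathrm{CPo}(\lambda,Q)\big)\;\le\; H(\lambda,Q)\,q\,\Big(\sqrt{\lambda\,J_{\mathbf Q,1}(S)}+D(\mathbf Q)\Big),$$ with the following notation. * $d_{TV}(P,P')=\tfrac12\sum_{x\ge0}|P(x)-P'(x)|$. For a distribution $R$ on $\mathbb Z_+$ and a distribution $Q$ on $\mathbb N$, $C_QR$ denotes the distribution of $\sum_{i=1}^{Y}X_i$, where $Y\sim R$ and the $X_i$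 are i.i.d. with distribution $Q$ and independent of $Y$; $\mathrm{CPo}(\lambda,Q)=C_Q\,\mathrm{Po}(\lambda)$. * Size-biased information: in general, for a sum $S=\sum_i Y_i\sim P$ of independent $Y_i\sim C_{Q_i}R_i$ put $p_i=E(Y_i)/q_i$, $\lambda=\sum_ip_i$, $R^{\#}(y)=(y+1)R(y+1)/\sum_k kR(k)$, and let $P^{(i)}$ be the distribution of the same sum with $Y_i$ replaced by an independent $Y_i'\sim C_{Q_i}(R_i^{\#})$ (terms with $p_i=0$ below are $0$). Then $$J_{\mathbf Q,1}(S)=\lambda\,E\big[r_1(S)^2\big],\qquad r_1(s)=\frac{\sum_i p_iP^{(i)}(s)}{\lambda P(s)}-1 .$$ Here it is taken with $R_i=\mathrm{Bern}(p_i)$. * Dissimilarity: $D(\mathbf Q)=\sum_{j=1}^\infty\sum_{i=1}^n\frac{j\,p_i}{q}\,|Q_i(j)-Q(j)|$. * Stein factor: if $\{jQ(j)\}_{j\ge1}$ is non-increasing, let $\delta=[\lambda\{Q(1)-2Q(2)\}]^{-1}$ ($=+\infty$ if $Q(1)=2Q(2)$) and set $H(\lambda,Q)=1$ if $\delta\ge1$,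 and $H(\lambda,Q)=\sqrt\delta\,(2-\sqrt\delta)$ if $\delta<1$. Otherwise $H(\lambda,Q)=e^\lambda\min\{1,\tfrac1{\lambda Q(1)}\}$ (with $1/0=+\infty$). -/

import Mathlib

open MeasureTheory ProbabilityTheory
open scoped ENNReal

namespace CompoundPoisson

noncomputable section

/-- `Q : ℕ → ℝ` is (the probability mass function of) a distribution on `{1, 2, ...}`. -/
def IsDistOnPos (Q : ℕ → ℝ) : Prop :=
  (∀ j, 0 ≤ Q j) ∧ Q 0 = 0 ∧ HasSum Q 1

/-- The mean of a distribution on `ℕ` (used only for distributions of finite mean). -/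
def mean (f : ℕ → ℝ) : ℝ := ∑' k : ℕ, (k : ℝ) * f k

/-- The convolution of a finite family of mass functions on `ℕ`: the mass at `s` is the sum of
`∏ i, f i (x i)` over all `x : ι → ℕ` with `∑ i, x i = s`. This is the distribution of a sum of
independent random variables with distributions `f i`; for an empty family it is the unit mass
at `0`. -/
def convMass {ι : Type*} [Fintype ι] [DecidableEq ι] (f : ι → ℕ → ℝ) (s : ℕ) : ℝ :=
  ∑ x ∈ Finset.piAntidiag Finset.univ s, ∏ i, f i (x i)

/-- The compound distribution `C_Q R`: the distribution of `X₁ + ⋯ + X_Y`, where `Y ∼ R` and the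
`X_i` are i.i.d. with distribution `Q`, independent of `Y`. -/
def compound (Q R : ℕ → ℝ) (s : ℕ) : ℝ :=
  ∑' k : ℕ, R k * convMass (fun _ : Fin k => Q) s

/-- The Bernoulli distribution with parameter `p`, as a mass function on `ℕ`. -/
def bernoulliMass (p : ℝ) (k : ℕ) : ℝ :=
  if k = 0 then 1 - p else if k = 1 then p else 0

/-- The compound Poisson distribution `CPo(lam, Q) = C_Q Po(lam)`, for `lam ≥ 0`. -/
def compoundPoisson (lam : ℝ) (Q : ℕ → ℝ) : ℕ → ℝ :=
  compound Q fun k => (poissonMeasure lam.toNNReal).real {k}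

/-- The total variation distance between two distributions on `ℕ`. -/
def tvDist (P P' : ℕ → ℝ) : ℝ := (1 / 2) * ∑' s : ℕ, |P s - P' s|

/-- The (reduced) size-biased distribution `R^#(y) = (y + 1) R(y + 1) / mean R`. -/
def sizeBias (R : ℕ → ℝ) (y : ℕ) : ℝ := ((y : ℝ) + 1) * R (y + 1) / mean R

section Information

variable {n : ℕ} (Q R : Fin n → ℕ → ℝ)

/-- The distribution `P` of `S = ∑ i, Y_i` with `Y_i ∼ C_{Q_i} R_i` independent. -/
def sumMass : ℕ → ℝ := convMass fun i => compound (Q i) (R i)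

/-- The distribution `P^(i)` of the same sum with `Y_i` replaced by an independent
`Y_i' ∼ C_{Q_i} (R_i^#)`. -/
def sumMassBiased (i : Fin n) : ℕ → ℝ :=
  convMass
    (Function.update (fun j => compound (Q j) (R j)) i (compound (Q i) (sizeBias (R i))))

/-- The weight `p_i = E(Y_i) / q_i`. -/
def weight (i : Fin n) : ℝ := mean (compound (Q i) (R i)) / mean (Q i)

/-- The score `r₁(s; P, Q) = (∑ i, p_i P^(i)(s)) / (lam P(s)) - 1`, where `lam = ∑ i, p_i`.
Its value where `P s = 0` never matters. -/
def score (s : ℕ) : ℝ :=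
  (∑ i, weight Q R i * sumMassBiased Q R i s) / ((∑ i, weight Q R i) * sumMass Q R s) - 1

/-- The size-biased information `J_{Q,1}(S) = lam * E[r₁(S; P, Q)²]`, with values in `[0, ∞]`. -/
def sizeBiasedInfo : ℝ≥0∞ :=
  ENNReal.ofReal (∑ i, weight Q R i) *
    ∑' s : ℕ, ENNReal.ofReal (sumMass Q R s * score Q R s ^ 2)

end Information

section Mixture

variable {n : ℕ} (p : Fin n → ℝ) (Q : Fin n → ℕ → ℝ)

/-- The mixture `Q = ∑ i, (p_i / lam) Q_i`, where `lam = ∑ i, p_i`. -/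
def mixture (j : ℕ) : ℝ := ∑ i, p i / (∑ k, p k) * Q i j

/-- The mean `q = (1 / lam) ∑ i, p_i q_i` of the mixture. -/
def mixtureMean : ℝ := (∑ i, p i * mean (Q i)) / ∑ i, p i

/-- The dissimilarity `D(Q) = ∑ j, ∑ i, (j p_i / q) |Q_i(j) - Q(j)|`, with values in `[0, ∞]`. -/
def dissimilarity : ℝ≥0∞ :=
  ∑' j : ℕ, ENNReal.ofReal
    (∑ i, (j : ℝ) * p i / mixtureMean p Q * |Q i j - mixture p Q j|)

end Mixture

section Stein

/-- With `δ = [lam (Q(1) - 2 Q(2))]⁻¹`, read as `+∞` when `Q(1) = 2 Q(2)`: the value is `1` if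
`δ ≥ 1` and `√δ (2 - √δ)` if `δ < 1`. -/
def steinFactorZero (lam : ℝ) (Q : ℕ → ℝ) : ℝ :=
  let δ : ℝ := (lam * (Q 1 - 2 * Q 2))⁻¹
  if Q 1 = 2 * Q 2 ∨ 1 ≤ δ then 1 else √δ * (2 - √δ)

open scoped Classical in
/-- The Stein factor `H(lam, Q)`. In the second case, `1 / (lam Q(1))` is read as `+∞` when
`Q(1) = 0`. -/
def steinFactor (lam : ℝ) (Q : ℕ → ℝ) : ℝ :=
  if ∀ j : ℕ, 1 ≤ j → ((j : ℝ) + 1) * Q (j + 1) ≤ (j : ℝ) * Q j then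
    steinFactorZero lam Q
  else
    Real.exp lam * (if Q 1 = 0 then 1 else min 1 (1 / (lam * Q 1)))

end Stein

end

end CompoundPoisson

/-! Stein's method, carried out in a commutative Banach algebra. Let E be the shift on bounded
sequences; its norm is at most 1. A summable sequence a gives an operator a(E) of norm at most ∑
|a_j|. For a mass function P, (P(E)φ)(0) is the mean of φ under P; convolution becomes
multiplication, and CPo(λ, Q) becomes exp(λ(Q(E) - 1)). Commuting with multiplication by the index
acts as d/dE (`IsDer`). With a = λQ the Stein equation is (a'(E)F)(k) - k F(k-1) = b(k). Evaluating
the commutator identity at 0, where the index factor vanishes, gives for every K with derivative K'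
(K b)(0) = ((K a'(E) - K') F)(0). (*)

Take K = P(E). Then P' = ∑ p_i Q_i' G_i, where G_i is the law of the sum without Y_i; this is P^(i)
when p_i > 0, because a size-biased Bernoulli variable is 0. Hence λQ'P - P' = Q'(λP - ∑ p_i G_i) +
∑ p_i (Q' - Q_i')G_i. The first term has norm at most q λ E|r₁|, which is at most q √(λJ) by
Cauchy–Schwarz, and the second at most q D (`act_sumMass_le`). It remains to bound ‖F‖ by H when b
is a centred indicator.

In general F(k) = -∫₀¹ x^k (exp(a(E) - a(xE)) b)(k+1) dx, and the exponential has norm at most exp(λ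
- a₁x) (`exists_steinEq`). If j a_j is non-increasing, put T = 1 - w + wE and M = exp(a(E) - a(T)).
Thinning lowers every coefficient of index at least 1 and keeps the total mass, so ‖M‖ ≤ 1. By (*),
w (T^k M F)(0) has w-derivative -(T^k M (E-1) b)(0), of modulus at most 1; as this path runs from 0
to F(k), ‖F‖ ≤ 1. Moreover M contains the factor exp(m(E-1)) with m = (1-w)(a₁ - 2a₂), and
‖exp(m(E-1))(E-1)‖ ≤ 1/√m. Integrating over w gives ‖F‖ ≤ (a₁ - 2a₂)^(-1/2) = √δ. -/

open scoped BoundedContinuousFunction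

namespace CompoundPoisson

/-! ### Power series with summable coefficients on the closed unit ball of a Banach algebra. -/

section PowerSum

variable {A : Type*} [NormedCommRing A] [NormedAlgebra ℝ A] [CompleteSpace A] [NormOneClass A]

/-- The sum of a power series with real coefficients in a Banach algebra. -/
noncomputable def powerSum (a : ℕ → ℝ) (x : A) : A := ∑' j, a j • x ^ j

/-- The coefficients of the formal derivative of a power series. -/
def derivCoeff (a : ℕ → ℝ) (j : ℕ) : ℝ := ((j : ℝ) + 1) * a (j + 1)

omit [NormedAlgebra ℝ A] [CompleteSpace A] in
lemma norm_pow_le_one_of_norm_le_one {x : A} (hx : ‖x‖ ≤ 1) (j : ℕ) : ‖x ^ j‖ ≤ 1 :=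
  (norm_pow_le x j).trans (pow_le_one₀ (norm_nonneg _) hx)

omit [CompleteSpace A] in
lemma norm_smul_pow_le (a : ℕ → ℝ) {x : A} (hx : ‖x‖ ≤ 1) (j : ℕ) : ‖a j • x ^ j‖ ≤ |a j| := by
  rw [norm_smul, Real.norm_eq_abs]
  exact mul_le_of_le_one_right (abs_nonneg _) (norm_pow_le_one_of_norm_le_one hx j)

lemma hasSum_powerSum {a : ℕ → ℝ} (ha : Summable a) {x : A} (hx : ‖x‖ ≤ 1) :
    HasSum (fun j => a j • x ^ j) (powerSum a x) :=
  (Summable.of_norm_bounded ha.abs (norm_smul_pow_le a hx)).hasSum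

omit [CompleteSpace A] in
lemma norm_powerSum_le {a : ℕ → ℝ} (ha : Summable a) {x : A} (hx : ‖x‖ ≤ 1) :
    ‖powerSum a x‖ ≤ ∑' j, |a j| :=
  tsum_of_norm_bounded ha.abs.hasSum (norm_smul_pow_le a hx)

lemma powerSum_one_real (a : ℕ → ℝ) : powerSum a (1 : ℝ) = ∑' j, a j := by
  simp [powerSum]

lemma powerSum_sub {a b : ℕ → ℝ} (ha : Summable a) (hb : Summable b) {x : A} (hx : ‖x‖ ≤ 1) :
    powerSum (fun j => a j - b j) x = powerSum a x - powerSum b x := by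
  refine HasSum.tsum_eq ?_
  simpa [sub_smul] using (hasSum_powerSum ha hx).sub (hasSum_powerSum hb hx)

lemma continuousOn_powerSum {a : ℕ → ℝ} (ha : Summable a) :
    ContinuousOn (powerSum a : A → A) {x | ‖x‖ ≤ 1} :=
  continuousOn_tsum (fun j => by fun_prop) ha.abs fun j _ hx => norm_smul_pow_le a hx j

/-- The segment may touch the boundary of the unit ball, so the usual theory inside the disc of
convergence is not enough; summability of j a_j dominates the termwise derivatives instead. It
serves the two segments xE and 1 + w(E - 1). -/
lemma hasDerivAt_powerSum_comp {a : ℕ → ℝ} (ha : Summable a) (ha' : Summable (derivCoeff a))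
    {u v : A} (h : ∀ t ∈ Set.Ioo (0 : ℝ) 1, ‖u + t • v‖ ≤ 1) {t : ℝ}
    (ht : t ∈ Set.Ioo (0 : ℝ) 1) :
    HasDerivAt (fun t : ℝ => powerSum a (u + t • v))
      (powerSum (derivCoeff a) (u + t • v) * v) t := by
  have hshift : Summable fun j : ℕ => |(j : ℝ) * a j| * ‖v‖ := by
    have h0 : Summable fun j : ℕ => |(j : ℝ) * a j| := by
      rw [← summable_nat_add_iff 1]
      simpa [derivCoeff] using ha'.abs
    exact h0.mul_right _
  have hline (t : ℝ) : HasDerivAt (fun t : ℝ => u + t • v) v t := by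
    have h := ((hasDerivAt_id' t).smul_const v).const_add u
    rwa [one_smul] at h
  have hterm (j : ℕ) (t : ℝ) : HasDerivAt (fun t : ℝ => a j • (u + t • v) ^ j)
      (a j • ((j : A) * (u + t • v) ^ (j - 1) * v)) t :=
    ((hline t).fun_pow j).const_smul (a j)
  have hbound : ∀ (j : ℕ) (t : ℝ), t ∈ Set.Ioo (0 : ℝ) 1 →
      ‖a j • ((j : A) * (u + t • v) ^ (j - 1) * v)‖ ≤ |(j : ℝ) * a j| * ‖v‖ := by
    intro j t ht
    rw [norm_smul, Real.norm_eq_abs, abs_mul, mul_comm |(j : ℝ)|, mul_assoc |a j|]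
    refine mul_le_mul_of_nonneg_left ?_ (abs_nonneg _)
    refine (norm_mul_le _ _).trans (mul_le_mul_of_nonneg_right ?_ (norm_nonneg _))
    refine (norm_mul_le _ _).trans ?_
    refine (mul_le_of_le_one_right (norm_nonneg _)
      (norm_pow_le_one_of_norm_le_one (h t ht) _)).trans ?_
    simpa using Nat.norm_cast_le (α := A) j
  have key := hasDerivAt_tsum_of_isPreconnected hshift isOpen_Ioo isPreconnected_Ioo
    (fun j t _ => hterm j t) hbound ht (hasSum_powerSum ha (h t ht)).summable ht
  have h1 := (hasSum_powerSum (x := u + t • v) ha' (h t ht)).mul_right v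
  have h2 : HasSum (fun j : ℕ => a j • ((j : A) * (u + t • v) ^ (j - 1) * v))
      (powerSum (derivCoeff a) (u + t • v) * v) := by
    rw [← hasSum_nat_add_iff' 1]
    simp only [Finset.range_one, Finset.sum_singleton, Nat.cast_zero, zero_mul, smul_zero,
      sub_zero]
    convert! h1 using 1
    funext j
    simp only [derivCoeff, Nat.add_sub_cancel, Algebra.smul_def, map_mul, map_add, map_natCast,
      map_one]
    push_cast
    ring
  rw [← h2.tsum_eq]
  exact key

lemma norm_exp_le (x : A) : ‖NormedSpace.exp x‖ ≤ Real.exp ‖x‖ := by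
  have h := NormedSpace.exp_series_hasSum_exp' (𝕂 := ℝ) x
  have h2 := NormedSpace.exp_series_hasSum_exp' (𝕂 := ℝ) ‖x‖
  rw [← Real.exp_eq_exp_ℝ] at h2
  rw [← h.tsum_eq]
  refine tsum_of_norm_bounded h2 fun j => ?_
  rw [norm_smul, smul_eq_mul, Real.norm_of_nonneg (by positivity)]
  exact mul_le_mul_of_nonneg_left (norm_pow_le x j) (by positivity)

omit [NormOneClass A] in
lemma exp_add' (x y : A) : NormedSpace.exp (x + y) = NormedSpace.exp x * NormedSpace.exp y := by
  let _ := NormedAlgebra.restrictScalars ℚ ℝ A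
  exact NormedSpace.exp_add

omit [CompleteSpace A] [NormOneClass A] in
lemma exp_algebraMap (c : ℝ) :
    NormedSpace.exp (c • (1 : A)) = Real.exp c • (1 : A) := by
  rw [← Algebra.algebraMap_eq_smul_one, ← Algebra.algebraMap_eq_smul_one, Real.exp_eq_exp_ℝ]
  exact (NormedSpace.algebraMap_exp_comm (𝕂 := ℝ) (𝔸 := A) c).symm

/-- If all coefficients but the constant one are nonnegative, the exponential of the power series
is bounded by its value at one. -/
lemma norm_exp_powerSum_le {a : ℕ → ℝ} (ha : Summable a) (hpos : ∀ j, 1 ≤ j → 0 ≤ a j) {x : A}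
    (hx : ‖x‖ ≤ 1) : ‖NormedSpace.exp (powerSum a x)‖ ≤ Real.exp (∑' j, a j) := by
  -- The constant coefficient may be negative, so it is split off: it contributes the exact factor
  -- exp(a 0), and only the rest is estimated in norm.
  set b : ℕ → ℝ := fun j => a (j + 1)
  have hb : Summable b := (summable_nat_add_iff 1).2 ha
  have h1 : powerSum a x = a 0 • (1 : A) + powerSum b x * x := by
    rw [powerSum, (hasSum_powerSum ha hx).summable.tsum_eq_zero_add, powerSum, pow_zero,
      ← ((hasSum_powerSum hb hx).summable.tsum_mul_right x)]
    simp [b, pow_succ]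
  rw [h1, exp_add', exp_algebraMap, ha.tsum_eq_zero_add, Real.exp_add, smul_mul_assoc, one_mul,
    norm_smul, Real.norm_of_nonneg (Real.exp_pos _).le]
  refine mul_le_mul_of_nonneg_left ((norm_exp_le _).trans (Real.exp_le_exp.2 ?_))
    (Real.exp_pos _).le
  refine (norm_mul_le _ _).trans ((mul_le_of_le_one_right (norm_nonneg _) hx).trans ?_)
  refine (norm_powerSum_le hb hx).trans (le_of_eq (tsum_congr fun j => ?_))
  exact abs_of_nonneg (hpos _ (by omega))

end PowerSum

/-! ### Binomial thinning of the coefficients. -/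

section Thinning

variable {A : Type*} [NormedCommRing A] [NormedAlgebra ℝ A] [CompleteSpace A] [NormOneClass A]

/-- The coefficients of the power series `z ↦ ∑ i, a i * (1 - w + w * z) ^ i`. -/
noncomputable def thinCoeff (a : ℕ → ℝ) (w : ℝ) (j : ℕ) : ℝ :=
  ∑' i, a i * ((i.choose j : ℝ) * w ^ j * (1 - w) ^ (i - j))

omit [CompleteSpace A] in
lemma norm_thin_le {x : A} (hx : ‖x‖ ≤ 1) {w : ℝ} (h0 : 0 ≤ w) (h1 : w ≤ 1) :
    ‖(1 - w) • (1 : A) + w • x‖ ≤ 1 := by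
  refine (norm_add_le _ _).trans ?_
  rw [norm_smul, norm_smul, Real.norm_of_nonneg h0, Real.norm_of_nonneg (sub_nonneg.2 h1),
    norm_one]
  nlinarith

omit [CompleteSpace A] [NormOneClass A] in
lemma hasSum_thin_pow (x : A) (w : ℝ) (i : ℕ) :
    HasSum (fun j => ((i.choose j : ℝ) * w ^ j * (1 - w) ^ (i - j)) • x ^ j)
      (((1 - w) • (1 : A) + w • x) ^ i) := by
  have h : ((1 - w) • (1 : A) + w • x) ^ i =
      ∑ j ∈ Finset.range (i + 1), ((i.choose j : ℝ) * w ^ j * (1 - w) ^ (i - j)) • x ^ j := by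
    rw [add_comm, add_pow]
    refine Finset.sum_congr rfl fun j _ => ?_
    simp only [Algebra.smul_def, map_mul, map_pow, map_natCast, mul_pow]
    ring
  rw [h]
  refine hasSum_sum_of_ne_finset_zero fun j hj => ?_
  rw [Nat.choose_eq_zero_of_lt (by simpa using hj)]
  simp

lemma summable_thin {a : ℕ → ℝ} (ha : Summable a) (hpos : ∀ j, 0 ≤ a j) {w : ℝ}
    (h0 : 0 ≤ w) (h1 : w ≤ 1) :
    Summable fun ij : ℕ × ℕ =>
      a ij.1 * ((ij.1.choose ij.2 : ℝ) * w ^ ij.2 * (1 - w) ^ (ij.1 - ij.2)) := by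
  have hrow (i : ℕ) : HasSum (fun j => a i * ((i.choose j : ℝ) * w ^ j * (1 - w) ^ (i - j)))
      (a i) := by
    simpa using (hasSum_thin_pow (1 : ℝ) w i).mul_left (a i)
  have h1w : 0 ≤ 1 - w := sub_nonneg.2 h1
  rw [summable_prod_of_nonneg fun ij => by have := hpos ij.1; positivity]
  exact ⟨fun i => (hrow i).summable, by simpa only [(hrow _).tsum_eq] using ha⟩

lemma summable_thinCoeff {a : ℕ → ℝ} (ha : Summable a) (hpos : ∀ j, 0 ≤ a j) {w : ℝ}
    (h0 : 0 ≤ w) (h1 : w ≤ 1) : Summable (thinCoeff a w) :=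
  (summable_thin ha hpos h0 h1).prod_symm.prod

lemma powerSum_thin {a : ℕ → ℝ} (ha : Summable a) (hpos : ∀ j, 0 ≤ a j) {w : ℝ}
    (h0 : 0 ≤ w) (h1 : w ≤ 1) {x : A} (hx : ‖x‖ ≤ 1) :
    powerSum a ((1 - w) • (1 : A) + w • x) = powerSum (thinCoeff a w) x := by
  have hs := summable_thin ha hpos h0 h1
  have h1w : 0 ≤ 1 - w := sub_nonneg.2 h1
  have hf : Summable fun ij : ℕ × ℕ =>
      (a ij.1 * ((ij.1.choose ij.2 : ℝ) * w ^ ij.2 * (1 - w) ^ (ij.1 - ij.2))) • x ^ ij.2 := by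
    refine Summable.of_norm_bounded hs fun ij => ?_
    have := hpos ij.1
    rw [norm_smul, Real.norm_of_nonneg (by positivity)]
    exact mul_le_of_le_one_right (by positivity) (norm_pow_le_one_of_norm_le_one hx _)
  have hcomm := hf.tsum_comm' (f := fun i j =>
    (a i * ((i.choose j : ℝ) * w ^ j * (1 - w) ^ (i - j))) • x ^ j)
    (fun i => hf.prod_factor i) (fun j => hf.prod_symm.prod_factor j)
  rw [powerSum, powerSum]
  refine Eq.trans ?_ (hcomm.symm.trans ?_)
  · refine tsum_congr fun i => ?_
    rw [← ((hasSum_thin_pow x w i).const_smul (a i)).tsum_eq]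
    simp only [smul_smul]
  · refine tsum_congr fun j => ?_
    rw [thinCoeff]
    exact ((hs.prod_symm.prod_factor j).tsum_smul_const _)

lemma tsum_thinCoeff {a : ℕ → ℝ} (ha : Summable a) (hpos : ∀ j, 0 ≤ a j) {w : ℝ}
    (h0 : 0 ≤ w) (h1 : w ≤ 1) : ∑' j, thinCoeff a w j = ∑' j, a j := by
  have h := powerSum_thin (A := ℝ) ha hpos h0 h1 (x := 1) (by simp)
  simp only [smul_eq_mul, mul_one, sub_add_cancel] at h
  rw [← powerSum_one_real, ← powerSum_one_real, h]

lemma mul_succ_le_of_antitone {a : ℕ → ℝ}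
    (hanti : ∀ j : ℕ, 1 ≤ j → ((j : ℝ) + 1) * a (j + 1) ≤ (j : ℝ) * a j) {j : ℕ} (hj : 1 ≤ j)
    (n : ℕ) : ((j + n : ℕ) : ℝ) * a (j + n) ≤ (j : ℝ) * a j := by
  induction n with
  | zero => simp
  | succ n ih =>
    refine le_trans ?_ ih
    have := hanti (j + n) (by omega)
    push_cast at this ⊢
    rw [← add_assoc j n 1, ← add_assoc (j : ℝ) n 1]
    exact this

/-- From j C(i,j) = i C(i-1,j-1) and i a_i ≤ j a_j follows a_i C(i,j) ≤ a_j C(i-1,j-1) for i ≥ j.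
The weights C(i-1,j-1) w^j (1-w)^(i-j) are negative binomial and sum to 1. -/
lemma thinCoeff_le {a : ℕ → ℝ} (ha : Summable a) (hpos : ∀ j, 0 ≤ a j)
    (hanti : ∀ j : ℕ, 1 ≤ j → ((j : ℝ) + 1) * a (j + 1) ≤ (j : ℝ) * a j) {w : ℝ}
    (h0 : 0 < w) (h1 : w ≤ 1) {j : ℕ} (hj : 1 ≤ j) : thinCoeff a w j ≤ a j := by
  have hrow : Summable fun i => a i * ((i.choose j : ℝ) * w ^ j * (1 - w) ^ (i - j)) :=
    (summable_thin ha hpos h0.le h1).prod_symm.prod_factor j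
  have h1w : 0 ≤ 1 - w := sub_nonneg.2 h1
  obtain ⟨m, rfl⟩ : ∃ m, j = m + 1 := ⟨j - 1, by omega⟩
  have hgeo := hasSum_choose_mul_geometric_of_norm_lt_one (𝕜 := ℝ) m (r := 1 - w)
    (by rw [Real.norm_of_nonneg h1w]; linarith)
  rw [sub_sub_cancel] at hgeo
  have hgeo' := hgeo.mul_left (a (m + 1) * w ^ (m + 1))
  rw [mul_assoc, mul_one_div_cancel (by positivity), mul_one] at hgeo'
  rw [thinCoeff, ← hrow.sum_add_tsum_nat_add (m + 1), Finset.sum_eq_zero, zero_add]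
  · refine (((summable_nat_add_iff (m + 1)).2 hrow).tsum_le_tsum (fun n => ?_)
      hgeo'.summable).trans_eq hgeo'.tsum_eq
    have h2 := mul_succ_le_of_antitone hanti hj n
    have h3 : ((n + (m + 1)).choose (m + 1) : ℝ) * ((m : ℝ) + 1) =
        ((n + m : ℕ) + 1 : ℝ) * ((n + m).choose m : ℝ) := by
      exact_mod_cast (Nat.add_one_mul_choose_eq (n + m) m).symm
    have h4 : a (n + (m + 1)) * ((n + (m + 1)).choose (m + 1) : ℝ) ≤
        a (m + 1) * ((n + m).choose m : ℝ) := by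
      refine le_of_mul_le_mul_right ?_ (show (0 : ℝ) < (m : ℝ) + 1 by positivity)
      rw [mul_assoc, h3, add_comm n (m + 1)]
      push_cast at h2 ⊢
      have := mul_le_mul_of_nonneg_right h2 (Nat.cast_nonneg (α := ℝ) ((n + m).choose m))
      linarith
    rw [Nat.add_sub_cancel]
    calc _ = a (n + (m + 1)) * ((n + (m + 1)).choose (m + 1) : ℝ) * (w ^ (m + 1) * (1 - w) ^ n) :=
          by ring
      _ ≤ a (m + 1) * ((n + m).choose m : ℝ) * (w ^ (m + 1) * (1 - w) ^ n) :=
          mul_le_mul_of_nonneg_right h4 (by positivity)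
      _ = _ := by ring
  · intro i hi
    rw [Nat.choose_eq_zero_of_lt (by simpa using hi)]
    simp

/-- The term i = 1 is kept exactly as w a₁; for i ≥ 2 the bound i a_i ≤ 2 a₂ leaves a geometric
series with sum 2 a₂ (1-w). The gain over `thinCoeff_le` is the rate of the Poisson part split off
below. -/
lemma thinCoeff_one_le {a : ℕ → ℝ} (ha : Summable a) (hpos : ∀ j, 0 ≤ a j)
    (hanti : ∀ j : ℕ, 1 ≤ j → ((j : ℝ) + 1) * a (j + 1) ≤ (j : ℝ) * a j) {w : ℝ}
    (h0 : 0 < w) (h1 : w ≤ 1) : thinCoeff a w 1 ≤ a 1 - (1 - w) * (a 1 - 2 * a 2) := by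
  have hrow : Summable fun i => a i * ((i.choose 1 : ℝ) * w ^ 1 * (1 - w) ^ (i - 1)) :=
    (summable_thin ha hpos h0.le h1).prod_symm.prod_factor 1
  have h1w : 0 ≤ 1 - w := sub_nonneg.2 h1
  have hgeo := (hasSum_geometric_of_lt_one h1w (by linarith)).mul_left
    (2 * a 2 * w * (1 - w))
  rw [sub_sub_cancel] at hgeo
  rw [thinCoeff, ← hrow.sum_add_tsum_nat_add 2]
  have h5 : ∑' i, a (i + 2) * (((i + 2).choose 1 : ℝ) * w ^ 1 * (1 - w) ^ (i + 2 - 1)) ≤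
      2 * a 2 * w * (1 - w) * w⁻¹ := by
    refine (((summable_nat_add_iff 2).2 hrow).tsum_le_tsum (fun n => ?_)
      hgeo.summable).trans_eq hgeo.tsum_eq
    have h2 := mul_succ_le_of_antitone hanti (j := 2) (by norm_num) n
    rw [Nat.choose_one_right, add_comm n 2, show 2 + n - 1 = n + 1 by omega]
    have := mul_le_mul_of_nonneg_right h2 (show 0 ≤ w * (1 - w) ^ (n + 1) by positivity)
    calc _ = ((2 + n : ℕ) : ℝ) * a (2 + n) * (w * (1 - w) ^ (n + 1)) := by ring
      _ ≤ _ := this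
      _ = _ := by push_cast; ring
  have h6 : 2 * a 2 * w * (1 - w) * w⁻¹ = 2 * a 2 * (1 - w) := by
    field_simp
  rw [h6] at h5
  simp [Finset.sum_range_succ] at h5 ⊢
  linarith

end Thinning

/-! ### Contractivity and Poisson smoothing of the exponentials. -/

section Smoothing

variable {A : Type*} [NormedCommRing A] [NormedAlgebra ℝ A] [CompleteSpace A] [NormOneClass A]

lemma hasSum_poisson_sq (m : ℝ) :
    HasSum (fun k : ℕ => ((k : ℝ) - m) ^ 2 * (m ^ k / k.factorial)) (m * Real.exp m) := by
  have h0 : HasSum (fun k : ℕ => m ^ k / k.factorial) (Real.exp m) := by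
    rw [Real.exp_eq_exp_ℝ]; exact NormedSpace.expSeries_div_hasSum_exp m
  have h1 : HasSum (fun k : ℕ => (k : ℝ) * (m ^ k / k.factorial)) (m * Real.exp m) := by
    rw [← hasSum_nat_add_iff' 1]
    simp only [Finset.range_one, Finset.sum_singleton, Nat.cast_zero, zero_mul, sub_zero]
    convert! h0.mul_left m using 1
    funext k
    rw [Nat.factorial_succ]
    push_cast
    field_simp
    ring
  have h2 : HasSum (fun k : ℕ => (k : ℝ) * (k - 1) * (m ^ k / k.factorial))
      (m * (m * Real.exp m)) := by
    rw [← hasSum_nat_add_iff' 1]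
    simp only [Finset.range_one, Finset.sum_singleton, Nat.cast_zero, zero_mul, sub_zero]
    convert! h1.mul_left m using 1
    funext k
    rw [Nat.factorial_succ]
    push_cast
    field_simp
    ring
  convert! (h2.add (h1.mul_left (1 - 2 * m))).add (h0.mul_left (m ^ 2)) using 1
  · funext k; ring
  · ring

/-- The smoothing effect of a Poisson number of steps. -/
lemma norm_exp_mul_sub_one_le {x : A} (hx : ‖x‖ ≤ 1) {m : ℝ} (hm : 0 < m) :
    ‖NormedSpace.exp (m • (x - 1)) * (x - 1)‖ ≤ 1 / √m := by
  have h0 : HasSum (fun k : ℕ => (m ^ k / k.factorial) • x ^ k) (NormedSpace.exp (m • x)) := by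
    convert! NormedSpace.exp_series_hasSum_exp' (𝕂 := ℝ) (m • x) using 1
    funext k
    rw [smul_pow, smul_smul]
    congr 1
    ring
  have h1 : HasSum (fun k : ℕ => ((k : ℝ) * (m ^ k / k.factorial)) • x ^ k)
      (m • (NormedSpace.exp (m • x) * x)) := by
    rw [← hasSum_nat_add_iff' 1]
    simp only [Finset.range_one, Finset.sum_singleton, Nat.cast_zero, zero_mul, sub_zero,
      zero_smul]
    convert! (h0.mul_right x).const_smul m using 1
    funext k
    rw [smul_mul_assoc, ← pow_succ, smul_smul, Nat.factorial_succ]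
    congr 1
    push_cast
    field_simp
    ring
  have h2 : HasSum (fun k : ℕ => (((k : ℝ) - m) * (m ^ k / k.factorial)) • x ^ k)
      (m • (NormedSpace.exp (m • x) * (x - 1))) := by
    convert! h1.sub (h0.const_smul m) using 1
    · funext k
      rw [smul_smul, ← sub_smul]
      congr 1
      ring
    · rw [← smul_sub, mul_sub, mul_one]
  have hs : 0 < √m := Real.sqrt_pos.2 hm
  have hexp : HasSum (fun k : ℕ => m ^ k / k.factorial) (Real.exp m) := by
    rw [Real.exp_eq_exp_ℝ]; exact NormedSpace.expSeries_div_hasSum_exp m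
  have h3 : ‖m • (NormedSpace.exp (m • x) * (x - 1))‖ ≤ √m * Real.exp m := by
    rw [← h2.tsum_eq]
    have hbd := ((hasSum_poisson_sq m).mul_left (1 / (2 * √m))).add (hexp.mul_left (√m / 2))
    have hval : 1 / (2 * √m) * (m * Real.exp m) + √m / 2 * Real.exp m = √m * Real.exp m := by
      field_simp
      rw [Real.sq_sqrt hm.le]
      ring
    rw [hval] at hbd
    refine tsum_of_norm_bounded hbd fun k => ?_
    refine (norm_smul_pow_le (fun k : ℕ => ((k : ℝ) - m) * (m ^ k / k.factorial)) hx k).trans ?_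
    rw [abs_mul, abs_of_nonneg (show 0 ≤ m ^ k / (k.factorial : ℝ) by positivity), ← mul_assoc,
      ← add_mul]
    refine mul_le_mul_of_nonneg_right ?_ (by positivity)
    -- AM-GM with weight √m in place of Cauchy–Schwarz: since the Poisson variance is m, it still
    -- bounds the mean absolute deviation by √m.
    have h4 : 1 / (2 * √m) * ((k : ℝ) - m) ^ 2 + √m / 2 - |(k : ℝ) - m| =
        (|(k : ℝ) - m| - √m) ^ 2 / (2 * √m) := by
      rw [← sq_abs ((k : ℝ) - m)]
      field_simp
      ring
    have h5 : 0 ≤ (|(k : ℝ) - m| - √m) ^ 2 / (2 * √m) := by positivity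
    linarith
  have h6 : NormedSpace.exp (m • (x - 1)) * (x - 1) =
      (Real.exp (-m) / m) • (m • (NormedSpace.exp (m • x) * (x - 1))) := by
    rw [smul_sub, sub_eq_add_neg, ← neg_smul, exp_add', exp_algebraMap, smul_smul,
      div_mul_cancel₀ _ hm.ne', mul_smul_comm, mul_one, smul_mul_assoc]
  rw [h6, norm_smul, Real.norm_of_nonneg (by positivity)]
  refine (mul_le_mul_of_nonneg_left h3 (by positivity)).trans_eq ?_
  rw [Real.exp_neg]
  have := Real.exp_pos m
  field_simp
  exact Real.sq_sqrt hm.le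

/-- The difference of exponents along the thinning semigroup, split into a Poisson part and a
remainder with a contractive exponential. -/
lemma exists_thin_decomposition {a : ℕ → ℝ} (ha : Summable a) (hpos : ∀ j, 0 ≤ a j)
    (hanti : ∀ j : ℕ, 1 ≤ j → ((j : ℝ) + 1) * a (j + 1) ≤ (j : ℝ) * a j) {w : ℝ}
    (h0 : 0 < w) (h1 : w ≤ 1) {x : A} (hx : ‖x‖ ≤ 1) {m : ℝ}
    (hm : m ≤ (1 - w) * (a 1 - 2 * a 2)) :
    ∃ y : A, ‖NormedSpace.exp y‖ ≤ 1 ∧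
      powerSum a x - powerSum a ((1 - w) • (1 : A) + w • x) = m • (x - 1) + y := by
  -- The coefficients of m(x - 1). Removing them keeps the total mass of the difference at 0 and, by
  -- `thinCoeff_one_le`, its coefficient at 1 nonnegative.
  set d : ℕ → ℝ := fun j => if j = 0 then -m else if j = 1 then m else 0
  have hd : HasSum d 0 := by
    have h : ∑ j ∈ Finset.range 2, d j = 0 := by simp [d, Finset.sum_range_succ]
    rw [← h]
    refine hasSum_sum_of_ne_finset_zero fun j hj => ?_
    have : ¬ j < 2 := by simpa using hj
    simp [d, show j ≠ 0 by omega, show j ≠ 1 by omega]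
  have hdx : powerSum d x = m • (x - 1) := by
    have h : ∑ j ∈ Finset.range 2, d j • x ^ j = m • (x - 1) := by
      simp [d, Finset.sum_range_succ, smul_sub]
      abel
    rw [← h]
    refine HasSum.tsum_eq (hasSum_sum_of_ne_finset_zero fun j hj => ?_)
    have : ¬ j < 2 := by simpa using hj
    simp [d, show j ≠ 0 by omega, show j ≠ 1 by omega]
  have ht := summable_thinCoeff ha hpos h0.le h1
  refine ⟨powerSum (fun j => a j - thinCoeff a w j - d j) x, ?_, ?_⟩
  · have h := norm_exp_powerSum_le (a := fun j => a j - thinCoeff a w j - d j)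
      ((ha.sub ht).sub hd.summable) (fun j hj => ?_) hx
    · rwa [(ha.sub ht).tsum_sub hd.summable, ha.tsum_sub ht, tsum_thinCoeff ha hpos h0.le h1,
        hd.tsum_eq, sub_self, sub_self, Real.exp_zero] at h
    · rcases eq_or_ne j 1 with rfl | hj1
      · have := thinCoeff_one_le ha hpos hanti h0 h1
        simp only [d, one_ne_zero, if_false, if_true]
        linarith
      · have := thinCoeff_le ha hpos hanti h0 h1 hj
        simp only [d, show j ≠ 0 by omega, hj1, if_false]
        linarith
  · rw [powerSum_sub (ha.sub ht) hd.summable hx, powerSum_sub ha ht hx, hdx,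
      powerSum_thin ha hpos h0.le h1 hx]
    abel

lemma norm_exp_thin_le {a : ℕ → ℝ} (ha : Summable a) (hpos : ∀ j, 0 ≤ a j)
    (hanti : ∀ j : ℕ, 1 ≤ j → ((j : ℝ) + 1) * a (j + 1) ≤ (j : ℝ) * a j) {w : ℝ}
    (h0 : 0 < w) (h1 : w ≤ 1) {x : A} (hx : ‖x‖ ≤ 1) :
    ‖NormedSpace.exp (powerSum a x - powerSum a ((1 - w) • (1 : A) + w • x))‖ ≤ 1 := by
  have h2 := hanti 1 le_rfl
  norm_num at h2
  obtain ⟨y, hy, h⟩ := exists_thin_decomposition ha hpos hanti h0 h1 hx (m := 0)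
    (mul_nonneg (sub_nonneg.2 h1) (by linarith))
  rwa [h, zero_smul, zero_add]

lemma norm_exp_thin_mul_sub_one_le {a : ℕ → ℝ} (ha : Summable a) (hpos : ∀ j, 0 ≤ a j)
    (hanti : ∀ j : ℕ, 1 ≤ j → ((j : ℝ) + 1) * a (j + 1) ≤ (j : ℝ) * a j) {w : ℝ}
    (h0 : 0 < w) (h1 : w < 1) (hν : 0 < a 1 - 2 * a 2) {x : A} (hx : ‖x‖ ≤ 1) :
    ‖NormedSpace.exp (powerSum a x - powerSum a ((1 - w) • (1 : A) + w • x)) * (x - 1)‖ ≤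
      1 / √((1 - w) * (a 1 - 2 * a 2)) := by
  obtain ⟨y, hy, h⟩ := exists_thin_decomposition ha hpos hanti h0 h1.le hx le_rfl
  rw [h, add_comm, exp_add', mul_assoc]
  refine (norm_mul_le _ _).trans ((mul_le_of_le_one_left (norm_nonneg _) hy).trans ?_)
  exact norm_exp_mul_sub_one_le hx (mul_pos (by linarith) hν)

end Smoothing

/-! ### The commutative Banach algebra generated by the shift. -/

section Shift

/-- The shift `φ ↦ φ (· + 1)` on bounded sequences. -/
noncomputable def shiftOp : (ℕ →ᵇ ℝ) →L[ℝ] (ℕ →ᵇ ℝ) :=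
  LinearMap.mkContinuous
    { toFun := fun φ => φ.compContinuous ⟨fun k => k + 1, continuous_of_discreteTopology⟩
      map_add' := fun _ _ => rfl
      map_smul' := fun _ _ => rfl } 1 fun φ => by
    rw [one_mul]
    exact (BoundedContinuousFunction.norm_le (norm_nonneg _)).2 fun k => φ.norm_coe_le_norm _

@[simp] lemma shiftOp_apply (φ : ℕ →ᵇ ℝ) (k : ℕ) : shiftOp φ k = φ (k + 1) := rfl

lemma norm_shiftOp_le : ‖shiftOp‖ ≤ 1 := LinearMap.mkContinuous_norm_le _ zero_le_one _

/-- The Banach algebra of bounded operators on bounded sequences. -/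
def SeqOp : Type := (ℕ →ᵇ ℝ) →L[ℝ] (ℕ →ᵇ ℝ)

noncomputable instance : NormedRing SeqOp :=
  inferInstanceAs (NormedRing ((ℕ →ᵇ ℝ) →L[ℝ] (ℕ →ᵇ ℝ)))

noncomputable instance : NormedAlgebra ℝ SeqOp :=
  inferInstanceAs (NormedAlgebra ℝ ((ℕ →ᵇ ℝ) →L[ℝ] (ℕ →ᵇ ℝ)))

instance : CompleteSpace SeqOp :=
  inferInstanceAs (CompleteSpace ((ℕ →ᵇ ℝ) →L[ℝ] (ℕ →ᵇ ℝ)))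

instance : NormOneClass SeqOp where
  norm_one := by
    have : Nontrivial (ℕ →ᵇ ℝ) :=
      ⟨0, BoundedContinuousFunction.const ℕ 1, fun h => zero_ne_one (DFunLike.congr_fun h 0)⟩
    exact ContinuousLinearMap.norm_id (𝕜 := ℝ) (E := ℕ →ᵇ ℝ)

/-- The shift, as an element of the algebra of bounded operators. -/
noncomputable def shiftSeqOp : SeqOp := shiftOp

/-- The commutative Banach algebra generated by the shift. -/
def ShiftAlg : Type := Algebra.elemental ℝ shiftSeqOp

noncomputable instance : NormedRing ShiftAlg :=
  inferInstanceAs (NormedRing (Algebra.elemental ℝ shiftSeqOp))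

noncomputable instance : NormedCommRing ShiftAlg where
  mul_comm a b := mul_comm (G := Algebra.elemental ℝ shiftSeqOp) a b

noncomputable instance : NormedAlgebra ℝ ShiftAlg :=
  inferInstanceAs (NormedAlgebra ℝ (Algebra.elemental ℝ shiftSeqOp))

instance : CompleteSpace ShiftAlg :=
  inferInstanceAs (CompleteSpace (Algebra.elemental ℝ shiftSeqOp))

instance : NormOneClass ShiftAlg := ⟨norm_one (α := SeqOp)⟩

/-- The shift, as an element of the algebra it generates. -/
noncomputable def shift : ShiftAlg := ⟨shiftSeqOp, Algebra.elemental.self_mem ℝ shiftSeqOp⟩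

lemma norm_shift_le : ‖shift‖ ≤ 1 := norm_shiftOp_le

/-- Evaluation of an operator at a bounded sequence. -/
noncomputable def act (G : ShiftAlg) (φ : ℕ →ᵇ ℝ) : ℕ →ᵇ ℝ :=
  (show (ℕ →ᵇ ℝ) →L[ℝ] (ℕ →ᵇ ℝ) from G.1) φ

lemma act_apply_le (G : ShiftAlg) (φ : ℕ →ᵇ ℝ) (k : ℕ) : |act G φ k| ≤ ‖G‖ * ‖φ‖ :=
  ((act G φ).norm_coe_le_norm k).trans (ContinuousLinearMap.le_opNorm (show (ℕ →ᵇ ℝ) →L[ℝ] (ℕ →ᵇ ℝ) from G.1) φ)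

@[simp] lemma act_shift (φ : ℕ →ᵇ ℝ) (k : ℕ) : act shift φ k = φ (k + 1) := rfl
@[simp] lemma act_one (φ : ℕ →ᵇ ℝ) : act 1 φ = φ := rfl
lemma act_mul (G H : ShiftAlg) (φ : ℕ →ᵇ ℝ) : act (G * H) φ = act G (act H φ) := rfl
lemma act_add (G H : ShiftAlg) (φ : ℕ →ᵇ ℝ) : act (G + H) φ = act G φ + act H φ := rfl
lemma act_sub (G H : ShiftAlg) (φ : ℕ →ᵇ ℝ) : act (G - H) φ = act G φ - act H φ := rfl
lemma act_smul (c : ℝ) (G : ShiftAlg) (φ : ℕ →ᵇ ℝ) : act (c • G) φ = c • act G φ := rfl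
lemma act_map_sub (G : ShiftAlg) (φ ψ : ℕ →ᵇ ℝ) : act G (φ - ψ) = act G φ - act G ψ :=
  map_sub (show (ℕ →ᵇ ℝ) →L[ℝ] (ℕ →ᵇ ℝ) from G.1) φ ψ

lemma act_shift_pow (j : ℕ) (φ : ℕ →ᵇ ℝ) (k : ℕ) : act (shift ^ j) φ k = φ (k + j) := by
  induction j generalizing k with
  | zero => simp
  | succ j ih => rw [pow_succ', act_mul, act_shift, ih]; congr 1; omega

/-- Evaluation at a fixed sequence and index, as a continuous functional on operators. -/
noncomputable def evalAct (φ : ℕ →ᵇ ℝ) (k : ℕ) : ShiftAlg →L[ℝ] ℝ :=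
  LinearMap.mkContinuous
    { toFun := fun G => act G φ k
      map_add' := fun _ _ => rfl
      map_smul' := fun _ _ => rfl } ‖φ‖ fun G => by
    rw [mul_comm]
    exact act_apply_le G φ k

@[simp] lemma evalAct_apply (φ : ℕ →ᵇ ℝ) (k : ℕ) (G : ShiftAlg) : evalAct φ k G = act G φ k := rfl

lemma hasSum_act_powerSum {a : ℕ → ℝ} (ha : Summable a) (φ : ℕ →ᵇ ℝ) (k : ℕ) :
    HasSum (fun j => a j * φ (k + j)) (act (powerSum a shift) φ k) := by
  have h := (hasSum_powerSum ha norm_shift_le).mapL (evalAct φ k)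
  simpa [act_shift_pow] using h

end Shift

/-! ### The formal derivative as a commutator with the index. -/

section Derivation

/-- `IsDer G G'` expresses that `G'` is the commutator of `G` with multiplication by the index
(composed with the backward shift), that is, the formal derivative of `G` in the shift. -/
def IsDer (G G' : ShiftAlg) : Prop :=
  ∀ φ ψ : ℕ →ᵇ ℝ, (∀ k : ℕ, ψ k = k * φ (k - 1)) →
    ∀ k : ℕ, act G ψ k = k * act G φ (k - 1) + act G' φ k

lemma isDer_one : IsDer 1 0 := fun φ ψ h k => by
  rw [act_one, act_one, h]
  exact (add_zero _).symm

lemma isDer_shift : IsDer shift 1 := fun φ ψ h k => by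
  rw [act_shift, act_one, act_shift, h]
  rcases k with _ | k
  · simp
  · simp; ring

namespace IsDer

variable {G G' H H' : ShiftAlg}

lemma add (hG : IsDer G G') (hH : IsDer H H') : IsDer (G + H) (G' + H') := fun φ ψ h k => by
  simp only [act_add, BoundedContinuousFunction.add_apply, hG φ ψ h k, hH φ ψ h k]
  ring

lemma smul (c : ℝ) (hG : IsDer G G') : IsDer (c • G) (c • G') := fun φ ψ h k => by
  simp only [act_smul, BoundedContinuousFunction.smul_apply, hG φ ψ h k, smul_eq_mul]
  ring

lemma sub (hG : IsDer G G') (hH : IsDer H H') : IsDer (G - H) (G' - H') := fun φ ψ h k => by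
  simp only [act_sub, BoundedContinuousFunction.sub_apply, hG φ ψ h k, hH φ ψ h k]
  ring

lemma mul (hG : IsDer G G') (hH : IsDer H H') : IsDer (G * H) (G' * H + G * H') :=
  fun φ ψ h k => by
  -- By the hypothesis on `H`, this pair is again related as `φ` and `ψ` are, so the hypothesis on
  -- `G` applies to it.
  have h1 := hG (act H φ) (act H ψ - act H' φ) (fun k => by
    rw [BoundedContinuousFunction.sub_apply, hH φ ψ h k]; ring) k
  rw [act_map_sub, BoundedContinuousFunction.sub_apply] at h1
  simp only [act_add, act_mul, BoundedContinuousFunction.add_apply] at h1 ⊢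
  linarith

lemma pow (hG : IsDer G G') (n : ℕ) : IsDer (G ^ n) ((n : ℝ) • (G ^ (n - 1) * G')) := by
  induction n with
  | zero => simpa using isDer_one
  | succ n ih =>
    have h := ih.mul hG
    rw [← pow_succ] at h
    convert! h using 1
    rcases n with _ | n
    · simp
    · simp only [Algebra.smul_def, Nat.add_sub_cancel, map_natCast]
      push_cast
      ring

lemma hasSum {G G' : ℕ → ShiftAlg} {s s' : ShiftAlg} (h : ∀ j, IsDer (G j) (G' j))
    (hs : HasSum G s) (hs' : HasSum G' s') : IsDer s s' := fun φ ψ hφ k => by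
  have h1 := hs.mapL (evalAct ψ k)
  have h2 := ((hs.mapL (evalAct φ (k - 1))).mul_left (k : ℝ)).add (hs'.mapL (evalAct φ k))
  refine h1.unique ?_
  simpa only [evalAct_apply, h _ φ ψ hφ k] using h2

lemma powerSum {a : ℕ → ℝ} (ha : Summable a) (ha' : Summable (derivCoeff a)) (hG : IsDer G G')
    (hn : ‖G‖ ≤ 1) : IsDer (powerSum a G) (powerSum (derivCoeff a) G * G') := by
  refine hasSum (fun j => (hG.pow j).smul (a j)) (hasSum_powerSum ha hn) ?_
  rw [← hasSum_nat_add_iff' 1]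
  simp only [Finset.range_one, Finset.sum_singleton, Nat.cast_zero, zero_smul, smul_zero, sub_zero]
  convert! (hasSum_powerSum ha' hn).mul_right G' using 1
  funext j
  rw [smul_smul, smul_mul_assoc, Nat.add_sub_cancel, derivCoeff]
  push_cast
  rw [mul_comm]

lemma exp (hG : IsDer G G') : IsDer (NormedSpace.exp G) (NormedSpace.exp G * G') := by
  have h := NormedSpace.exp_series_hasSum_exp' (𝕂 := ℝ) G
  refine hasSum (fun j => (hG.pow j).smul _) h ?_
  rw [← hasSum_nat_add_iff' 1]
  simp only [Finset.range_one, Finset.sum_singleton, Nat.cast_zero, zero_smul, smul_zero, sub_zero]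
  convert! h.mul_right G' using 1
  funext j
  rw [smul_smul, smul_mul_assoc, Nat.add_sub_cancel, Nat.factorial_succ]
  congr 1
  push_cast
  field_simp

end IsDer

end Derivation

/-! ### Existence of a bounded solution of the Stein equation, and the exponential Stein factor. -/

section SteinEquation

/-- The Stein equation for the compound Poisson distribution with jump intensities `a`, for the
solution `F k = f (k + 1)`. -/
def SteinEq (a : ℕ → ℝ) (b F : ℕ →ᵇ ℝ) : Prop :=
  ∀ k : ℕ, act (powerSum (derivCoeff a) shift) F k - k * F (k - 1) = b k

variable {a : ℕ → ℝ}

/-- The operator whose average along `x ∈ [0, 1]` solves the Stein equation. -/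
noncomputable def steinKernel (a : ℕ → ℝ) (x : ℝ) : ShiftAlg :=
  NormedSpace.exp (powerSum a shift - powerSum a (x • shift))

lemma norm_smul_shift_le {x : ℝ} (hx : x ∈ Set.Icc (0 : ℝ) 1) : ‖x • shift‖ ≤ 1 := by
  rw [norm_smul, Real.norm_of_nonneg hx.1]
  exact mul_le_one₀ hx.2 (norm_nonneg _) norm_shift_le

lemma continuousOn_powerSum_smul (ha : Summable a) :
    ContinuousOn (fun x : ℝ => powerSum a (x • shift)) (Set.Icc 0 1) :=
  (continuousOn_powerSum ha).comp (by fun_prop) fun _ hx => norm_smul_shift_le hx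

lemma continuous_exp {A : Type*} [NormedCommRing A] [NormedAlgebra ℝ A] [CompleteSpace A] :
    Continuous (NormedSpace.exp : A → A) :=
  continuous_iff_continuousAt.2 fun x => (hasFDerivAt_exp (𝕂 := ℝ) (x := x)).continuousAt

lemma continuousOn_steinKernel (ha : Summable a) :
    ContinuousOn (steinKernel a) (Set.Icc 0 1) :=
  continuous_exp.comp_continuousOn
    (continuousOn_const.sub (continuousOn_powerSum_smul ha))

lemma hasDerivAt_exp_comp {A : Type*} [NormedCommRing A] [NormedAlgebra ℝ A] [CompleteSpace A]
    {f : ℝ → A} {f' : A} {t : ℝ} (h : HasDerivAt f f' t) :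
    HasDerivAt (fun t => NormedSpace.exp (f t)) (NormedSpace.exp (f t) * f') t :=
  (hasFDerivAt_exp (𝕂 := ℝ) (x := f t)).comp_hasDerivAt t h

lemma hasDerivAt_steinKernel (ha : Summable a) (ha' : Summable (derivCoeff a)) {x : ℝ}
    (hx : x ∈ Set.Ioo (0 : ℝ) 1) :
    HasDerivAt (steinKernel a)
      (-(steinKernel a x * (powerSum (derivCoeff a) (x • shift) * shift))) x := by
  have h := hasDerivAt_powerSum_comp ha ha' (u := 0) (v := shift)
    (fun t ht => by rw [zero_add]; exact norm_smul_shift_le (Set.Ioo_subset_Icc_self ht)) hx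
  simp only [zero_add] at h
  have h2 := hasDerivAt_exp_comp (h.const_sub (powerSum a shift))
  rw [mul_neg] at h2
  exact h2

/-- The exponent has coefficients a_j (1 - x^j) ≥ 0, so `norm_exp_powerSum_le` applies; of the sum ∑
a_j x^j only the term j = 1 is kept. -/
lemma norm_steinKernel_le (ha : Summable a) (hpos : ∀ j, 0 ≤ a j) {x : ℝ}
    (hx : x ∈ Set.Icc (0 : ℝ) 1) : ‖steinKernel a x‖ ≤ Real.exp (∑' j, a j - a 1 * x) := by
  have hle (j : ℕ) : x ^ j ≤ 1 := pow_le_one₀ hx.1 hx.2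
  have hax : Summable fun j => a j * x ^ j :=
    Summable.of_nonneg_of_le (fun j => mul_nonneg (hpos j) (pow_nonneg hx.1 j))
      (fun j => mul_le_of_le_one_right (hpos j) (hle j)) ha
  have h1 : powerSum a (x • shift) = powerSum (fun j => a j * x ^ j) shift :=
    tsum_congr fun j => by rw [smul_pow, smul_smul]
  rw [steinKernel, h1, ← powerSum_sub ha hax norm_shift_le]
  refine (norm_exp_powerSum_le (ha.sub hax) (fun j _ => ?_) norm_shift_le).trans
    (Real.exp_le_exp.2 ?_)
  · have := mul_le_of_le_one_right (hpos j) (hle j)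
    linarith
  · rw [ha.tsum_sub hax]
    have := hax.le_tsum 1 fun j _ => mul_nonneg (hpos j) (pow_nonneg hx.1 j)
    rw [pow_one] at this
    linarith

/-- The integrand of the solution of the Stein equation. -/
noncomputable def steinIntegrand (a : ℕ → ℝ) (b : ℕ →ᵇ ℝ) (k : ℕ) (x : ℝ) : ℝ :=
  x ^ k * act (steinKernel a x) b (k + 1)

lemma continuousOn_act {f : ℝ → ShiftAlg} {s : Set ℝ} (hf : ContinuousOn f s) (b : ℕ →ᵇ ℝ)
    (k : ℕ) : ContinuousOn (fun x => act (f x) b k) s :=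
  (evalAct b k).continuous.comp_continuousOn hf

lemma continuousOn_steinIntegrand (ha : Summable a) (b : ℕ →ᵇ ℝ) (k : ℕ) :
    ContinuousOn (steinIntegrand a b k) (Set.Icc 0 1) :=
  (continuousOn_pow k).mul (continuousOn_act (continuousOn_steinKernel ha) b (k + 1))

lemma abs_steinIntegrand_le (ha : Summable a) (hpos : ∀ j, 0 ≤ a j) {b : ℕ →ᵇ ℝ} (hb : ‖b‖ ≤ 1)
    (k : ℕ) {x : ℝ} (hx : x ∈ Set.Icc (0 : ℝ) 1) :
    |steinIntegrand a b k x| ≤ Real.exp (∑' j, a j - a 1 * x) := by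
  rw [steinIntegrand, abs_mul, abs_of_nonneg (pow_nonneg hx.1 k)]
  refine (mul_le_of_le_one_left (abs_nonneg _) (pow_le_one₀ hx.1 hx.2)).trans ?_
  refine (act_apply_le _ _ _).trans ?_
  exact (mul_le_of_le_one_right (norm_nonneg _) hb).trans (norm_steinKernel_le ha hpos hx)

lemma intervalIntegrable_of_continuousOn_Icc {f : ℝ → ℝ} (hf : ContinuousOn f (Set.Icc 0 1)) :
    IntervalIntegrable f volume 0 1 :=
  ContinuousOn.intervalIntegrable (by rwa [Set.uIcc_of_le zero_le_one])

lemma integral_exp_le {s c : ℝ} (hc : 0 ≤ c) :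
    ∫ x in (0 : ℝ)..1, Real.exp (s - c * x) ≤
      Real.exp s * (if c = 0 then 1 else min 1 (1 / c)) := by
  rcases hc.eq_or_lt with rfl | hc
  · simp
  rw [if_neg hc.ne', mul_min_of_nonneg _ _ (Real.exp_pos s).le]
  have hcont : Continuous fun x : ℝ => Real.exp (s - c * x) := by fun_prop
  refine le_min ?_ ?_
  · have h : ∫ x in (0 : ℝ)..1, Real.exp (s - c * x) ≤ ∫ x in (0 : ℝ)..1, Real.exp s := by
      refine intervalIntegral.integral_mono_on zero_le_one (hcont.intervalIntegrable _ _)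
        (by simp) fun x hx => Real.exp_le_exp.2 ?_
      have := mul_nonneg hc.le hx.1
      linarith
    simpa using h
  · have hd (x : ℝ) : HasDerivAt (fun x => -(1 / c) * Real.exp (s - c * x))
        (Real.exp (s - c * x)) x := by
      have h1 : HasDerivAt (fun x => s - c * x) (-c) x := by
        simpa using ((hasDerivAt_id x).const_mul c).const_sub s
      convert! (h1.exp.const_mul (-(1 / c))) using 1
      field_simp
    rw [intervalIntegral.integral_eq_sub_of_hasDerivAt (fun x _ => hd x)
      (hcont.intervalIntegrable _ _)]
    have := Real.exp_pos (s - c * 1)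
    have h2 : 0 ≤ 1 / c * Real.exp (s - c * 1) := by positivity
    simp only [mul_zero, sub_zero]
    linarith

/-- The solution of the Stein equation. -/
noncomputable def steinSol (a : ℕ → ℝ) (b : ℕ →ᵇ ℝ) (k : ℕ) : ℝ :=
  -∫ x in (0 : ℝ)..1, steinIntegrand a b k x

lemma abs_steinSol_le (ha : Summable a) (hpos : ∀ j, 0 ≤ a j) {b : ℕ →ᵇ ℝ} (hb : ‖b‖ ≤ 1)
    (k : ℕ) :
    |steinSol a b k| ≤ Real.exp (∑' j, a j) * (if a 1 = 0 then 1 else min 1 (1 / a 1)) := by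
  rw [steinSol, abs_neg, ← Real.norm_eq_abs]
  refine le_trans (intervalIntegral.norm_integral_le_of_norm_le zero_le_one
    (Filter.Eventually.of_forall fun x hx => ?_) ?_) (integral_exp_le (hpos 1))
  · exact abs_steinIntegrand_le ha hpos hb k (Set.Ioc_subset_Icc_self hx)
  · exact Continuous.intervalIntegrable (by fun_prop) _ _

/-- The x-derivative of x^k (exp(a(E) - a(xE)) b)(k) is k times the integrand at k - 1 minus the
a'-weighted sum of the integrands at k + j. Integrating over [0, 1] leaves b(k) from x = 1 and
nothing from x = 0. -/
lemma steinSol_spec (ha : Summable a) (hpos : ∀ j, 0 ≤ a j) (ha0 : a 0 = 0)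
    (ha' : Summable (derivCoeff a)) {b : ℕ →ᵇ ℝ} (hb : ‖b‖ ≤ 1)
    (hb0 : act (NormedSpace.exp (powerSum a shift)) b 0 = 0) (k : ℕ) :
    HasSum (fun j => derivCoeff a j * steinSol a b (k + j)) (b k + k * steinSol a b (k - 1)) := by
  set D : ℝ → ℝ := fun x =>
    x ^ k * act (steinKernel a x * (powerSum (derivCoeff a) (x • shift) * shift)) b k with hD
  have hDcont : ContinuousOn D (Set.Icc 0 1) :=
    (continuousOn_pow k).mul (continuousOn_act ((continuousOn_steinKernel ha).mul
      ((continuousOn_powerSum_smul ha').mul continuousOn_const)) b k)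
  have hDsum (x : ℝ) (hx : x ∈ Set.Icc (0 : ℝ) 1) :
      HasSum (fun j => derivCoeff a j * steinIntegrand a b (k + j) x) (D x) := by
    have h := ((hasSum_powerSum ha' (norm_smul_shift_le hx)).mul_right shift).mapL
      (evalAct (act (steinKernel a x) b) k)
    have h2 := h.mul_left (x ^ k)
    convert! h2 using 1
    · funext j
      rw [steinIntegrand, smul_pow, smul_smul, smul_mul_assoc, ← pow_succ, map_smul,
        evalAct_apply, act_shift_pow, smul_eq_mul, pow_add, ← add_assoc]
      ring
    · rw [evalAct_apply, ← act_mul, mul_comm _ (steinKernel a x)]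
  have hsum := intervalIntegral.hasSum_integral_of_dominated_convergence
    (μ := volume) (a := (0 : ℝ)) (b := 1)
    (F := fun (j : ℕ) (x : ℝ) => derivCoeff a j * steinIntegrand a b (k + j) x) (f := D)
    (fun (j : ℕ) (_ : ℝ) => |derivCoeff a j| * Real.exp (∑' j, a j))
    (fun j => by
      rw [Set.uIoc_of_le zero_le_one]
      exact ((continuousOn_const.mul (continuousOn_steinIntegrand ha b (k + j))).mono
        Set.Ioc_subset_Icc_self).aestronglyMeasurable measurableSet_Ioc)
    (fun j => Filter.Eventually.of_forall fun x hx => by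
      rw [Set.uIoc_of_le zero_le_one] at hx
      have hx' := Set.Ioc_subset_Icc_self hx
      rw [Real.norm_eq_abs, abs_mul]
      refine mul_le_mul_of_nonneg_left ((abs_steinIntegrand_le ha hpos hb _ hx').trans
        (Real.exp_le_exp.2 ?_)) (abs_nonneg _)
      have := mul_nonneg (hpos 1) hx'.1
      linarith)
    (Filter.Eventually.of_forall fun x _ => ha'.abs.mul_right _)
    intervalIntegrable_const
    (Filter.Eventually.of_forall fun x hx => by
      rw [Set.uIoc_of_le zero_le_one] at hx
      exact hDsum x (Set.Ioc_subset_Icc_self hx))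
  simp only [intervalIntegral.integral_const_mul] at hsum
  have hsum' := hsum.neg
  simp only [← mul_neg] at hsum'
  convert! hsum' using 1
  have hk1 : ContinuousOn (fun x => (k : ℝ) * steinIntegrand a b (k - 1) x) (Set.Icc 0 1) :=
    continuousOn_const.mul (continuousOn_steinIntegrand ha b (k - 1))
  have hftc := intervalIntegral.integral_eq_sub_of_hasDerivAt_of_le (zero_le_one (α := ℝ))
    (f := fun x => x ^ k * act (steinKernel a x) b k)
    (f' := fun x => k * steinIntegrand a b (k - 1) x - D x)
    ((continuousOn_pow k).mul (continuousOn_act (continuousOn_steinKernel ha) b k))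
    (fun x hx => by
      have h1 := (evalAct b k).hasFDerivAt.comp_hasDerivAt x (hasDerivAt_steinKernel ha ha' hx)
      have h2 := (hasDerivAt_pow k x).mul h1
      convert! h2 using 1
      rw [hD, map_neg, evalAct_apply, mul_neg, ← sub_eq_add_neg]
      congr 1
      rcases k with _ | k
      · simp
      · simp only [steinIntegrand, Nat.add_sub_cancel, Function.comp_apply, evalAct_apply]
        ring)
    (intervalIntegrable_of_continuousOn_Icc (hk1.sub hDcont))
  rw [intervalIntegral.integral_sub (intervalIntegrable_of_continuousOn_Icc hk1)
    (intervalIntegrable_of_continuousOn_Icc hDcont), intervalIntegral.integral_const_mul] at hftc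
  have hone : act (steinKernel a 1) b k = b k := by
    rw [steinKernel, one_smul, sub_self, NormedSpace.exp_zero, act_one]
  -- For k = 0 the power is 0^0 = 1, and the boundary term vanishes only because b has mean zero
  -- under the compound Poisson law (`hb0`).
  have hzero : (0 : ℝ) ^ k * act (steinKernel a 0) b k = 0 := by
    rcases k with _ | k
    · have : powerSum a ((0 : ℝ) • shift) = 0 := by
        rw [powerSum, zero_smul, tsum_eq_single 0 fun j hj => by simp [hj]]
        simp [ha0]
      rw [steinKernel, this, sub_zero, hb0, mul_zero]
    · simp
  rw [hone, hzero, one_pow, one_mul, sub_zero] at hftc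
  rw [steinSol]
  linarith

/-- The Stein equation has a bounded solution. -/
lemma exists_steinEq (ha : Summable a) (hpos : ∀ j, 0 ≤ a j) (ha0 : a 0 = 0)
    (ha' : Summable (derivCoeff a)) {b : ℕ →ᵇ ℝ} (hb : ‖b‖ ≤ 1)
    (hb0 : act (NormedSpace.exp (powerSum a shift)) b 0 = 0) :
    ∃ F : ℕ →ᵇ ℝ, SteinEq a b F ∧
      ‖F‖ ≤ Real.exp (∑' j, a j) * (if a 1 = 0 then 1 else min 1 (1 / a 1)) := by
  have hbd := abs_steinSol_le ha hpos hb
  refine ⟨BoundedContinuousFunction.ofNormedAddCommGroupDiscrete (steinSol a b) _ hbd,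
    fun k => ?_, ?_⟩
  · have h := (hasSum_act_powerSum ha' (BoundedContinuousFunction.ofNormedAddCommGroupDiscrete
      (steinSol a b) _ hbd) k).unique (steinSol_spec ha hpos ha0 ha' hb hb0 k)
    rw [h]
    exact add_sub_cancel_right _ _
  · exact (BoundedContinuousFunction.norm_le ((abs_nonneg _).trans (hbd 0))).2 hbd

end SteinEquation

/-! ### Bounds on the solution when j a_j is non-increasing. -/

section MonotoneCase

variable {a : ℕ → ℝ}

/-- Both B - φ and B + φ are monotone. Derivatives are required only in the open interval because
the comparison function -√((1-w)ν)/ν has infinite slope at w = 1. -/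
lemma abs_sub_le_of_abs_deriv_le {φ φ' B B' : ℝ → ℝ} (hφ : ContinuousOn φ (Set.Icc 0 1))
    (hB : ContinuousOn B (Set.Icc 0 1)) (hφ' : ∀ w ∈ Set.Ioo (0 : ℝ) 1, HasDerivAt φ (φ' w) w)
    (hB' : ∀ w ∈ Set.Ioo (0 : ℝ) 1, HasDerivAt B (B' w) w)
    (hle : ∀ w ∈ Set.Ioo (0 : ℝ) 1, |φ' w| ≤ B' w) : |φ 1 - φ 0| ≤ B 1 - B 0 := by
  have h1 : MonotoneOn (fun w => B w - φ w) (Set.Icc 0 1) := by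
    refine monotoneOn_of_deriv_nonneg (convex_Icc 0 1) (hB.sub hφ) ?_ ?_
    · rw [interior_Icc]
      exact fun w hw =>
        ((hB' w hw).sub (hφ' w hw)).differentiableAt.differentiableWithinAt
    · rw [interior_Icc]
      intro w hw
      rw [((hB' w hw).fun_sub (hφ' w hw)).deriv]
      have := (abs_le.1 (hle w hw)).2
      linarith
  have h2 : MonotoneOn (fun w => B w + φ w) (Set.Icc 0 1) := by
    refine monotoneOn_of_deriv_nonneg (convex_Icc 0 1) (hB.add hφ) ?_ ?_
    · rw [interior_Icc]
      exact fun w hw =>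
        ((hB' w hw).add (hφ' w hw)).differentiableAt.differentiableWithinAt
    · rw [interior_Icc]
      intro w hw
      rw [((hB' w hw).fun_add (hφ' w hw)).deriv]
      have := (abs_le.1 (hle w hw)).1
      linarith
  have h3 := h1 (Set.left_mem_Icc.2 zero_le_one) (Set.right_mem_Icc.2 zero_le_one) zero_le_one
  have h4 := h2 (Set.left_mem_Icc.2 zero_le_one) (Set.right_mem_Icc.2 zero_le_one) zero_le_one
  rw [abs_le]
  constructor <;> simp only at h3 h4 <;> linarith

/-- The thinned shift. -/
noncomputable def thinShift (w : ℝ) : ShiftAlg := (1 - w) • (1 : ShiftAlg) + w • shift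

lemma thinShift_eq (w : ℝ) : thinShift w = 1 + w • (shift - 1) := by
  rw [thinShift, sub_smul, smul_sub, one_smul]
  abel

lemma norm_thinShift_le {w : ℝ} (hw : w ∈ Set.Icc (0 : ℝ) 1) : ‖thinShift w‖ ≤ 1 :=
  norm_thin_le norm_shift_le hw.1 hw.2

lemma hasDerivAt_thinShift (w : ℝ) : HasDerivAt thinShift (shift - 1) w := by
  have h := ((hasDerivAt_id' w).smul_const (shift - 1)).const_add (1 : ShiftAlg)
  rw [one_smul] at h
  exact h.congr_of_eventuallyEq (Filter.Eventually.of_forall thinShift_eq)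

lemma continuous_thinShift : Continuous thinShift :=
  continuous_iff_continuousAt.2 fun w => (hasDerivAt_thinShift w).continuousAt

/-- The contribution of the immigrants to the thinning semigroup. -/
noncomputable def immigration (a : ℕ → ℝ) (w : ℝ) : ShiftAlg :=
  NormedSpace.exp (powerSum a shift - powerSum a (thinShift w))

lemma continuousOn_immigration (ha : Summable a) :
    ContinuousOn (immigration a) (Set.Icc 0 1) :=
  continuous_exp.comp_continuousOn (continuousOn_const.sub
    ((continuousOn_powerSum ha).comp continuous_thinShift.continuousOn
      fun _ hw => norm_thinShift_le hw))

lemma hasDerivAt_immigration (ha : Summable a) (ha' : Summable (derivCoeff a)) {w : ℝ}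
    (hw : w ∈ Set.Ioo (0 : ℝ) 1) :
    HasDerivAt (immigration a)
      (-(immigration a w * (powerSum (derivCoeff a) (thinShift w) * (shift - 1)))) w := by
  have h := hasDerivAt_powerSum_comp ha ha' (u := (1 : ShiftAlg)) (v := shift - 1)
    (fun t ht => by
      rw [← thinShift_eq]; exact norm_thinShift_le (Set.Ioo_subset_Icc_self ht)) hw
  simp only [← thinShift_eq] at h
  have h2 := hasDerivAt_exp_comp (h.const_sub (powerSum a shift))
  rw [mul_neg] at h2
  exact h2

lemma isDer_thinShift (w : ℝ) : IsDer (thinShift w) (w • 1) := by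
  have h := (isDer_one.smul (1 - w)).add (isDer_shift.smul w)
  rwa [smul_zero, zero_add] at h

lemma isDer_immigration (ha : Summable a) (ha' : Summable (derivCoeff a)) {w : ℝ}
    (hw : w ∈ Set.Icc (0 : ℝ) 1) :
    IsDer (immigration a w) (immigration a w * (powerSum (derivCoeff a) shift * 1 -
      powerSum (derivCoeff a) (thinShift w) * (w • 1))) :=
  ((isDer_shift.powerSum ha ha' norm_shift_le).sub
    ((isDer_thinShift w).powerSum ha ha' (norm_thinShift_le hw))).exp

/-- The interpolation between the solution of the Stein equation and zero. -/
noncomputable def steinPath (a : ℕ → ℝ) (F : ℕ →ᵇ ℝ) (k : ℕ) (w : ℝ) : ℝ :=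
  w * act (thinShift w ^ k * immigration a w) F 0

lemma steinPath_zero (F : ℕ →ᵇ ℝ) (k : ℕ) : steinPath a F k 0 = 0 := zero_mul _

lemma steinPath_one (F : ℕ →ᵇ ℝ) (k : ℕ) : steinPath a F k 1 = F k := by
  have h : thinShift 1 = shift := by rw [thinShift, sub_self, zero_smul, one_smul, zero_add]
  rw [steinPath, immigration, h, sub_self, NormedSpace.exp_zero, mul_one, one_mul, act_shift_pow,
    zero_add]

lemma continuousOn_steinPath (ha : Summable a) (F : ℕ →ᵇ ℝ) (k : ℕ) :
    ContinuousOn (steinPath a F k) (Set.Icc 0 1) :=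
  continuousOn_id.mul (continuousOn_act ((continuous_thinShift.pow k).continuousOn.mul
    (continuousOn_immigration ha)) F 0)

lemma hasDerivAt_steinPath (ha : Summable a) (ha' : Summable (derivCoeff a)) {b F : ℕ →ᵇ ℝ}
    (hF : SteinEq a b F) (k : ℕ) {w : ℝ} (hw : w ∈ Set.Ioo (0 : ℝ) 1) :
    HasDerivAt (steinPath a F k)
      (-act (thinShift w ^ k * (immigration a w * (shift - 1))) b 0) w := by
  have h1 := (hasDerivAt_thinShift w).fun_pow k
  have h2 := h1.mul (hasDerivAt_immigration ha ha' hw)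
  -- The direct product rule for the path. It must agree with the commutator identity for T^k M (E -
  -- 1), read at index 0 (`hder`), in which the Stein equation replaces k F(k-1) by a'(E)F - b; the
  -- a'(E) terms cancel there.
  have h3 := (evalAct F 0).hasFDerivAt.comp_hasDerivAt w h2
  have h4 := (hasDerivAt_id' w).mul h3
  have hder := ((((isDer_thinShift w).pow k).mul
    (isDer_immigration ha ha' (Set.Ioo_subset_Icc_self hw))).mul (isDer_shift.sub isDer_one))
    F (act (powerSum (derivCoeff a) shift) F - b) (fun k => by
      have := hF k
      rw [BoundedContinuousFunction.sub_apply]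
      linarith) 0
  rw [Nat.cast_zero, zero_mul, zero_add, act_map_sub, BoundedContinuousFunction.sub_apply,
    ← act_mul, sub_eq_iff_eq_add, ← sub_eq_iff_eq_add'] at hder
  convert! h4 using 1
  rw [← mul_assoc, ← hder, neg_sub, one_mul]
  simp only [← evalAct_apply F 0, Function.comp_apply, ← map_sub]
  have hw_mul (G : ShiftAlg) : w * evalAct F 0 G = evalAct F 0 (w • G) :=
    (map_smul (evalAct F 0) w G).symm
  rw [hw_mul, ← map_add]
  congr 1
  simp only [Algebra.smul_def, map_natCast, Pi.mul_apply]
  ring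

/-- The factor E - 1 kills constants, so b can be recentred to have norm at most 1/2; this saves a
factor 2. -/
lemma abs_act_le_of_add_const {b h : ℕ →ᵇ ℝ} {c r : ℝ} (hb : ∀ k, b k = h k + c)
    (hh : ‖h‖ ≤ 1 / 2) {G M : ShiftAlg} (hG : ‖G‖ ≤ 1) (hM : ‖M * (shift - 1)‖ ≤ 2 * r) :
    |act (G * (M * (shift - 1))) b 0| ≤ r := by
  have h1 : act (shift - 1) b = act (shift - 1) h := by
    ext k
    simp only [act_sub, BoundedContinuousFunction.sub_apply, act_shift, act_one, hb]
    ring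
  have h2 : act (G * (M * (shift - 1))) b 0 = act (G * (M * (shift - 1))) h 0 := by
    rw [← mul_assoc, act_mul, h1, ← act_mul]
  rw [h2]
  refine (act_apply_le _ _ _).trans ?_
  have h3 : ‖G * (M * (shift - 1))‖ ≤ 2 * r :=
    (norm_mul_le _ _).trans ((mul_le_of_le_one_left (norm_nonneg _) hG).trans hM)
  have h4 : 0 ≤ 2 * r := (norm_nonneg _).trans h3
  calc _ ≤ 2 * r * (1 / 2) := mul_le_mul h3 hh (norm_nonneg _) h4
    _ = r := by ring

lemma abs_le_one_of_steinEq (ha : Summable a) (ha' : Summable (derivCoeff a))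
    (hpos : ∀ j, 0 ≤ a j)
    (hanti : ∀ j : ℕ, 1 ≤ j → ((j : ℝ) + 1) * a (j + 1) ≤ (j : ℝ) * a j)
    {b h F : ℕ →ᵇ ℝ} {c : ℝ} (hb : ∀ k, b k = h k + c) (hh : ‖h‖ ≤ 1 / 2) (hF : SteinEq a b F)
    (k : ℕ) : |F k| ≤ 1 := by
  have key := abs_sub_le_of_abs_deriv_le (continuousOn_steinPath ha F k) (B := fun w => w)
    (B' := fun _ => 1) continuousOn_id (fun w hw => hasDerivAt_steinPath ha ha' hF k hw)
    (fun w _ => hasDerivAt_id' w) (fun w hw => ?_)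
  · simpa [steinPath_zero, steinPath_one] using key
  · rw [abs_neg]
    refine abs_act_le_of_add_const hb hh
      (norm_pow_le_one_of_norm_le_one (norm_thinShift_le (Set.Ioo_subset_Icc_self hw)) k) ?_
    refine (norm_mul_le _ _).trans ?_
    have h1 := norm_exp_thin_le ha hpos hanti hw.1 hw.2.le norm_shift_le
    have h2 : ‖shift - 1‖ ≤ 2 := by
      have h3 := norm_sub_le shift (1 : ShiftAlg)
      have h4 := norm_shift_le
      rw [norm_one] at h3
      linarith
    calc _ ≤ 1 * (2 : ℝ) := mul_le_mul h1 h2 (norm_nonneg _) zero_le_one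
      _ = 2 * 1 := by ring

lemma abs_le_inv_sqrt_of_steinEq (ha : Summable a) (ha' : Summable (derivCoeff a))
    (hpos : ∀ j, 0 ≤ a j)
    (hanti : ∀ j : ℕ, 1 ≤ j → ((j : ℝ) + 1) * a (j + 1) ≤ (j : ℝ) * a j)
    {b h F : ℕ →ᵇ ℝ} {c : ℝ} (hb : ∀ k, b k = h k + c) (hh : ‖h‖ ≤ 1 / 2) (hF : SteinEq a b F)
    (hν : 0 < a 1 - 2 * a 2) (k : ℕ) : |F k| ≤ 1 / √(a 1 - 2 * a 2) := by
  set ν := a 1 - 2 * a 2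
  -- The comparison function is an antiderivative of half the smoothing bound 1/√((1-w)ν); its
  -- increment over [0, 1] is 1/√ν.
  have key := abs_sub_le_of_abs_deriv_le (continuousOn_steinPath ha F k)
    (B := fun w => -(1 / ν) * √((1 - w) * ν)) (B' := fun w => 1 / (2 * √((1 - w) * ν)))
    (by fun_prop) (fun w hw => hasDerivAt_steinPath ha ha' hF k hw)
    (fun w hw => ?_) (fun w hw => ?_)
  · rw [steinPath_zero, steinPath_one, sub_zero] at key
    refine key.trans_eq ?_
    have hs : 0 < √ν := Real.sqrt_pos.2 hν
    simp only [sub_self, zero_mul, Real.sqrt_zero, mul_zero, sub_zero, one_mul, zero_sub, neg_mul,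
      neg_neg]
    rw [one_div_mul_eq_div, div_eq_div_iff hν.ne' hs.ne', Real.mul_self_sqrt hν.le, one_mul]
  · have hpos' : 0 < (1 - w) * ν := mul_pos (sub_pos.2 hw.2) hν
    have h1 : HasDerivAt (fun w => (1 - w) * ν) (-1 * ν) w :=
      ((hasDerivAt_id' w).const_sub 1).mul_const ν
    convert! (h1.sqrt hpos'.ne').const_mul (-(1 / ν)) using 1
    field_simp
  · rw [abs_neg]
    refine abs_act_le_of_add_const hb hh
      (norm_pow_le_one_of_norm_le_one (norm_thinShift_le (Set.Ioo_subset_Icc_self hw)) k) ?_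
    refine (norm_exp_thin_mul_sub_one_le ha hpos hanti hw.1 hw.2 hν norm_shift_le).trans_eq ?_
    rw [one_div, one_div, mul_inv]
    ring

end MonotoneCase

/-- A solution of the Stein equation bounded by the Stein factor. -/
lemma exists_steinEq_le_steinFactor {lam : ℝ} (hlam : 0 < lam) {Q : ℕ → ℝ} (hQ : IsDistOnPos Q)
    (hmean : Summable fun j : ℕ => (j : ℝ) * Q j) {b h : ℕ →ᵇ ℝ} {c : ℝ}
    (hb : ∀ k, b k = h k + c) (hh : ‖h‖ ≤ 1 / 2) (hb1 : ‖b‖ ≤ 1)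
    (hb0 : act (NormedSpace.exp (powerSum (fun j => lam * Q j) shift)) b 0 = 0) :
    ∃ F : ℕ →ᵇ ℝ, SteinEq (fun j => lam * Q j) b F ∧ ‖F‖ ≤ steinFactor lam Q := by
  set a : ℕ → ℝ := fun j => lam * Q j with ha_def
  have ha : Summable a := hQ.2.2.summable.mul_left lam
  have hpos (j : ℕ) : 0 ≤ a j := mul_nonneg hlam.le (hQ.1 j)
  have ha0 : a 0 = 0 := by simp [ha_def, hQ.2.1]
  have ha' : Summable (derivCoeff a) := by
    refine (((summable_nat_add_iff 1).2 hmean).mul_left lam).congr fun j => ?_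
    simp only [derivCoeff, ha_def]
    push_cast
    ring
  have hsum : ∑' j, a j = lam := by rw [tsum_mul_left, hQ.2.2.tsum_eq, mul_one]
  obtain ⟨F, hF, hFn⟩ := exists_steinEq ha hpos ha0 ha' hb1 hb0
  refine ⟨F, hF, ?_⟩
  rw [steinFactor]
  split_ifs with hmono h1
  · have hanti (j : ℕ) (hj : 1 ≤ j) : ((j : ℝ) + 1) * a (j + 1) ≤ (j : ℝ) * a j := by
      have := mul_le_mul_of_nonneg_left (hmono j hj) hlam.le
      simp only [ha_def]
      linarith
    have hF1 := abs_le_one_of_steinEq ha ha' hpos hanti hb hh hF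
    simp only [steinFactorZero]
    split_ifs with h
    · exact (BoundedContinuousFunction.norm_le zero_le_one).2 hF1
    · push Not at h
      have hνeq : a 1 - 2 * a 2 = lam * (Q 1 - 2 * Q 2) := by simp only [ha_def]; ring
      have hν : 0 < lam * (Q 1 - 2 * Q 2) := by
        have h3 := hmono 1 le_rfl
        norm_num at h3
        exact mul_pos hlam (sub_pos.2 (lt_of_le_of_ne h3 h.1.symm))
      have hF2 := abs_le_inv_sqrt_of_steinEq ha ha' hpos hanti hb hh hF (hνeq ▸ hν)
      rw [hνeq, one_div, ← Real.sqrt_inv] at hF2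
      set δ := (lam * (Q 1 - 2 * Q 2))⁻¹
      have h4 : √δ ≤ 1 := Real.sqrt_le_one.2 h.2.le
      -- The bound obtained is √δ itself, which for δ < 1 is stronger than the stated factor.
      have h5 : √δ ≤ √δ * (2 - √δ) := le_mul_of_one_le_right (Real.sqrt_nonneg _) (by linarith)
      exact (BoundedContinuousFunction.norm_le ((Real.sqrt_nonneg _).trans h5)).2
        fun k => (hF2 k).trans h5
  · have h2 : a 1 = 0 := by simp [ha_def, h1]
    rwa [hsum, if_pos h2] at hFn
  · have h2 : a 1 ≠ 0 := mul_ne_zero hlam.ne' h1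
    rwa [hsum, if_neg h2] at hFn

/-! ### Convolution of mass functions through formal power series. -/

section Convolution

/-- The convolution of two sequences. -/
def convPair (a b : ℕ → ℝ) (n : ℕ) : ℝ :=
  ∑ kl ∈ Finset.HasAntidiagonal.antidiagonal n, a kl.1 * b kl.2

/-- The unit mass at zero. -/
def unitMass (k : ℕ) : ℝ := if k = 0 then 1 else 0

/-- A mass function of total mass one. -/
def IsMass (f : ℕ → ℝ) : Prop := (∀ j, 0 ≤ f j) ∧ HasSum f 1

lemma mk_convPair (a b : ℕ → ℝ) :
    PowerSeries.mk (convPair a b) = PowerSeries.mk a * PowerSeries.mk b := by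
  ext n
  simp [PowerSeries.coeff_mul, convPair]

lemma mk_unitMass : PowerSeries.mk unitMass = 1 := by
  ext n
  simp [PowerSeries.coeff_one, unitMass]

lemma mk_derivCoeff (a : ℕ → ℝ) :
    PowerSeries.mk (derivCoeff a) = PowerSeries.derivative ℝ (PowerSeries.mk a) := by
  ext n
  simp [PowerSeries.coeff_derivative, derivCoeff, mul_comm]

lemma mk_injective {a b : ℕ → ℝ} (h : PowerSeries.mk a = PowerSeries.mk b) : a = b := by
  funext n
  simpa using congrArg (PowerSeries.coeff n) h

lemma mk_convMass {ι : Type*} [Fintype ι] [DecidableEq ι] (f : ι → ℕ → ℝ) :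
    PowerSeries.mk (convMass f) = ∏ i, PowerSeries.mk (f i) := by
  ext n
  rw [PowerSeries.coeff_mk, PowerSeries.coeff_prod, convMass]
  simp only [PowerSeries.coeff_mk]
  refine Finset.sum_bij' (fun x _ => Finsupp.equivFunOnFinite.symm x) (fun x _ => ⇑x)
    ?_ ?_ ?_ ?_ ?_
  · intro x hx
    simpa using hx
  · intro x hx
    simpa using hx
  · intro x _
    rfl
  · intro x _
    ext; rfl
  · intro x _
    rfl

variable {A : Type*} [NormedCommRing A] [NormedAlgebra ℝ A] [CompleteSpace A] [NormOneClass A]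

lemma summable_convPair {a b : ℕ → ℝ} (ha : Summable a) (hb : Summable b) :
    Summable (convPair a b) :=
  (summable_norm_sum_mul_antidiagonal_of_summable_norm ha.norm hb.norm).of_norm

lemma powerSum_convPair {a b : ℕ → ℝ} (ha : Summable a) (hb : Summable b) {x : A}
    (hx : ‖x‖ ≤ 1) : powerSum (convPair a b) x = powerSum a x * powerSum b x := by
  rw [powerSum, powerSum, powerSum, tsum_mul_tsum_eq_tsum_sum_antidiagonal_of_summable_norm
    (ha.abs.of_nonneg_of_le (fun _ => norm_nonneg _) (norm_smul_pow_le a hx))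
    (hb.abs.of_nonneg_of_le (fun _ => norm_nonneg _) (norm_smul_pow_le b hx))]
  refine tsum_congr fun n => ?_
  rw [convPair, Finset.sum_smul]
  refine Finset.sum_congr rfl fun kl hkl => ?_
  rw [smul_mul_smul_comm, ← pow_add, Finset.HasAntidiagonal.mem_antidiagonal.1 hkl]

lemma IsMass.convPair {a b : ℕ → ℝ} (ha : IsMass a) (hb : IsMass b) :
    IsMass (convPair a b) := by
  refine ⟨fun n => Finset.sum_nonneg fun kl _ => mul_nonneg (ha.1 _) (hb.1 _), ?_⟩
  have h := powerSum_convPair (A := ℝ) ha.2.summable hb.2.summable (x := 1) (by simp)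
  rw [powerSum_one_real, powerSum_one_real, powerSum_one_real, ha.2.tsum_eq, hb.2.tsum_eq,
    mul_one] at h
  exact h ▸ (summable_convPair ha.2.summable hb.2.summable).hasSum

lemma isMass_unitMass : IsMass unitMass := by
  refine ⟨fun k => by unfold unitMass; split_ifs <;> simp, ?_⟩
  convert! hasSum_ite_eq (0 : ℕ) (1 : ℝ) using 1

lemma isMass_coeff_prod {ι : Type*} (s : Finset ι) {f : ι → ℕ → ℝ} (hf : ∀ i, IsMass (f i)) :
    IsMass fun n => PowerSeries.coeff n (∏ i ∈ s, PowerSeries.mk (f i)) := by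
  classical
  induction s using Finset.induction_on with
  | empty =>
    convert! isMass_unitMass using 1
    funext n
    simp [PowerSeries.coeff_one, unitMass]
  | insert i s hi ih =>
    convert! (hf i).convPair ih using 1
    funext n
    rw [Finset.prod_insert hi, PowerSeries.coeff_mul]
    simp [CompoundPoisson.convPair]

lemma isMass_convMass {ι : Type*} [Fintype ι] [DecidableEq ι] {f : ι → ℕ → ℝ}
    (hf : ∀ i, IsMass (f i)) : IsMass (convMass f) := by
  convert! isMass_coeff_prod Finset.univ hf using 1
  funext n
  rw [← mk_convMass, PowerSeries.coeff_mk]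

lemma mk_convMass_const (Q : ℕ → ℝ) (k : ℕ) :
    PowerSeries.mk (convMass fun _ : Fin k => Q) = PowerSeries.mk Q ^ k := by
  rw [mk_convMass, Finset.prod_const, Finset.card_univ, Fintype.card_fin]

lemma convMass_const_succ (Q : ℕ → ℝ) (k : ℕ) :
    convMass (fun _ : Fin (k + 1) => Q) = convPair Q (convMass fun _ : Fin k => Q) :=
  mk_injective (by rw [mk_convPair, mk_convMass_const, mk_convMass_const, pow_succ'])

lemma convMass_const_zero (Q : ℕ → ℝ) : convMass (fun _ : Fin 0 => Q) = unitMass :=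
  mk_injective (by rw [mk_convMass_const, pow_zero, mk_unitMass])

lemma convMass_const_one (Q : ℕ → ℝ) : convMass (fun _ : Fin 1 => Q) = Q :=
  mk_injective (by rw [mk_convMass_const, pow_one])

omit [CompleteSpace A] [NormOneClass A] in
lemma powerSum_unitMass (x : A) : powerSum unitMass x = 1 := by
  rw [powerSum, tsum_eq_single 0 fun j hj => by simp [unitMass, hj]]
  simp [unitMass]

lemma powerSum_convMass_const {Q : ℕ → ℝ} (hQ : IsMass Q) {x : A} (hx : ‖x‖ ≤ 1) (k : ℕ) :
    powerSum (convMass fun _ : Fin k => Q) x = powerSum Q x ^ k := by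
  induction k with
  | zero => rw [convMass_const_zero, powerSum_unitMass, pow_zero]
  | succ k ih =>
    rw [convMass_const_succ, powerSum_convPair hQ.2.summable
      (isMass_convMass fun _ => hQ).2.summable hx, ih, pow_succ']

end Convolution

/-! ### Generating operators of compound laws. -/

section CompoundLaw

variable {A : Type*} [NormedCommRing A] [NormedAlgebra ℝ A] [CompleteSpace A] [NormOneClass A]

lemma summable_compound {Q R : ℕ → ℝ} (hQ : IsMass Q) (hR : IsMass R) :
    Summable fun ks : ℕ × ℕ => R ks.1 * convMass (fun _ : Fin ks.1 => Q) ks.2 := by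
  have hc (k : ℕ) : IsMass (convMass fun _ : Fin k => Q) := isMass_convMass fun _ => hQ
  have hnn (ks : ℕ × ℕ) : 0 ≤ R ks.1 * convMass (fun _ : Fin ks.1 => Q) ks.2 :=
    mul_nonneg (hR.1 _) ((hc _).1 _)
  have hrow (k : ℕ) : HasSum (fun s => R k * convMass (fun _ : Fin k => Q) s) (R k) := by
    simpa only [mul_one] using (hc k).2.mul_left (R k)
  refine (summable_prod_of_nonneg hnn).2 ⟨fun k => (hrow k).summable, ?_⟩
  exact hR.2.summable.congr fun k => (hrow k).tsum_eq.symm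

lemma compound_nonneg {Q R : ℕ → ℝ} (hQ : IsMass Q) (hR : IsMass R) (s : ℕ) :
    0 ≤ compound Q R s :=
  tsum_nonneg fun k => mul_nonneg (hR.1 k) ((isMass_convMass fun _ => hQ).1 s)

lemma hasSum_powerSum_compound {Q R : ℕ → ℝ} (hQ : IsMass Q) (hR : IsMass R) {x : A}
    (hx : ‖x‖ ≤ 1) :
    HasSum (fun k => R k • powerSum Q x ^ k) (powerSum (compound Q R) x) := by
  have hs := summable_compound hQ hR
  have hf : Summable fun ks : ℕ × ℕ =>
      (R ks.1 * convMass (fun _ : Fin ks.1 => Q) ks.2) • x ^ ks.2 := by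
    refine Summable.of_norm_bounded hs fun ks => ?_
    have h0 : 0 ≤ R ks.1 * convMass (fun _ : Fin ks.1 => Q) ks.2 :=
      mul_nonneg (hR.1 _) ((isMass_convMass fun _ => hQ).1 _)
    rw [norm_smul, Real.norm_of_nonneg h0]
    exact mul_le_of_le_one_right h0 (norm_pow_le_one_of_norm_le_one hx _)
  have hcomm := hf.tsum_comm' (f := fun k s =>
    (R k * convMass (fun _ : Fin k => Q) s) • x ^ s)
    (fun i => hf.prod_factor i) (fun j => hf.prod_symm.prod_factor j)
  have hrow (k : ℕ) : HasSum (fun s => (R k * convMass (fun _ : Fin k => Q) s) • x ^ s)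
      (R k • powerSum Q x ^ k) := by
    rw [← powerSum_convMass_const hQ hx k]
    simpa only [smul_smul] using
      (hasSum_powerSum (isMass_convMass fun _ => hQ).2.summable hx).const_smul (R k)
  have hcol : powerSum (compound Q R) x =
      ∑' s, ∑' k, (R k * convMass (fun _ : Fin k => Q) s) • x ^ s :=
    tsum_congr fun s => ((hs.prod_symm.prod_factor s).tsum_smul_const _).symm
  rw [hcol, hcomm]
  have := hf.prod.hasSum
  simpa only [(hrow _).tsum_eq] using this

lemma isMass_compound {Q R : ℕ → ℝ} (hQ : IsMass Q) (hR : IsMass R) :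
    IsMass (compound Q R) := by
  refine ⟨compound_nonneg hQ hR, ?_⟩
  have h := hasSum_powerSum_compound (A := ℝ) hQ hR (x := 1) (by simp)
  simp only [powerSum_one_real, hQ.2.tsum_eq, one_pow, smul_eq_mul, mul_one] at h
  rw [hR.2.unique h]
  exact (summable_compound hQ hR).prod_symm.prod.hasSum

lemma isMass_poisson (r : NNReal) : IsMass fun k => (poissonMeasure r).real {k} := by
  refine ⟨fun _ => measureReal_nonneg, ?_⟩
  simpa only [poissonMeasure_real_singleton] using hasSum_one_poissonMeasure r

lemma powerSum_compoundPoisson {Q : ℕ → ℝ} (hQ : IsMass Q) {lam : ℝ} (hlam : 0 ≤ lam) {x : A}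
    (hx : ‖x‖ ≤ 1) :
    powerSum (compoundPoisson lam Q) x =
      Real.exp (-lam) • NormedSpace.exp (powerSum (fun j => lam * Q j) x) := by
  have h1 : powerSum (fun j => lam * Q j) x = lam • powerSum Q x := by
    rw [powerSum, powerSum, ← (hasSum_powerSum hQ.2.summable hx).summable.tsum_const_smul]
    simp only [smul_smul]
  have h := hasSum_powerSum_compound hQ (isMass_poisson lam.toNNReal) hx
  refine h.unique ?_
  rw [h1]
  convert! (NormedSpace.exp_series_hasSum_exp' (𝕂 := ℝ) (lam • powerSum Q x)).const_smul
    (Real.exp (-lam)) using 1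
  funext k
  rw [poissonMeasure_real_singleton, Real.coe_toNNReal _ hlam, smul_pow, smul_smul, smul_smul]
  congr 1
  ring

lemma isMass_compoundPoisson {Q : ℕ → ℝ} (hQ : IsMass Q) (lam : ℝ) :
    IsMass (compoundPoisson lam Q) :=
  isMass_compound hQ (isMass_poisson _)

end CompoundLaw

/-! ### From total variation to the Stein equation. -/

section TotalVariation

/-- The positive part of x is (|x| + x)/2, and the differences P - P' sum to 0. -/
lemma tvDist_eq {P P' : ℕ → ℝ} (hP : IsMass P) (hP' : IsMass P') :
    tvDist P P' = ∑' s, (P s - P' s) * (if P' s ≤ P s then 1 else 0) := by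
  have hd := hP.2.sub hP'.2
  have h (s : ℕ) : (P s - P' s) * (if P' s ≤ P s then 1 else 0) =
      1 / 2 * |P s - P' s| + 1 / 2 * (P s - P' s) := by
    split_ifs with h
    · rw [abs_of_nonneg (sub_nonneg.2 h)]; ring
    · rw [abs_of_neg (sub_neg.2 (not_le.1 h))]; ring
  simp only [h]
  rw [(hd.summable.abs.mul_left _).tsum_add (hd.summable.mul_left _), tsum_mul_left,
    tsum_mul_left, hd.tsum_eq, tvDist]
  ring

/-- The total variation distance to a compound Poisson distribution through the Stein equation. -/
lemma exists_tvDist_eq {lam : ℝ} (hlam : 0 < lam) {Q : ℕ → ℝ} (hQ : IsDistOnPos Q)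
    (hmean : Summable fun j : ℕ => (j : ℝ) * Q j) {P : ℕ → ℝ} (hP : IsMass P) :
    ∃ b F : ℕ →ᵇ ℝ, SteinEq (fun j => lam * Q j) b F ∧ ‖F‖ ≤ steinFactor lam Q ∧
      tvDist P (compoundPoisson lam Q) = act (powerSum P shift) b 0 := by
  have hQm : IsMass Q := ⟨hQ.1, hQ.2.2⟩
  set C := compoundPoisson lam Q with hC
  have hCm : IsMass C := isMass_compoundPoisson hQm lam
  set ind : ℕ → ℝ := fun s => if C s ≤ P s then 1 else 0 with hind
  have hind01 (s : ℕ) : 0 ≤ ind s ∧ ind s ≤ 1 := by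
    simp only [hind]; split_ifs <;> simp
  have hsumI {f : ℕ → ℝ} (hf : IsMass f) : Summable fun s => f s * ind s :=
    hf.2.summable.of_nonneg_of_le (fun s => mul_nonneg (hf.1 s) (hind01 s).1)
      fun s => mul_le_of_le_one_right (hf.1 s) (hind01 s).2
  set c : ℝ := ∑' s, C s * ind s
  have hc0 : 0 ≤ c := tsum_nonneg fun s => mul_nonneg (hCm.1 s) (hind01 s).1
  have hc1 : c ≤ 1 := by
    rw [← hCm.2.tsum_eq]
    exact (hsumI hCm).tsum_le_tsum (fun s => mul_le_of_le_one_right (hCm.1 s) (hind01 s).2)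
      hCm.2.summable
  have hb1 (s : ℕ) : ‖ind s - c‖ ≤ 1 := by
    have := hind01 s
    rw [Real.norm_eq_abs, abs_le]
    constructor <;> linarith
  -- Two centrings of one indicator: at its compound Poisson mean c, which makes the equation
  -- solvable, and at 1/2, which minimises the norm. They differ by a constant.
  have hh1 (s : ℕ) : ‖ind s - 1 / 2‖ ≤ 1 / 2 := by
    have := hind01 s
    rw [Real.norm_eq_abs, abs_le]
    constructor <;> linarith
  set b := BoundedContinuousFunction.ofNormedAddCommGroupDiscrete (fun s => ind s - c) 1 hb1
    with hb
  set h := BoundedContinuousFunction.ofNormedAddCommGroupDiscrete (fun s => ind s - 1 / 2) _ hh1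
    with hh
  have hbs (s : ℕ) : b s = ind s - c := rfl
  have heval {f : ℕ → ℝ} (hf : IsMass f) :
      act (powerSum f shift) b 0 = ∑' s, f s * ind s - c := by
    refine (hasSum_act_powerSum hf.2.summable b 0).unique ?_
    have h2 := (hsumI hf).hasSum.sub (hf.2.mul_right c)
    rw [one_mul] at h2
    simpa only [zero_add, hbs, mul_sub] using h2
  obtain ⟨F, hF, hFn⟩ := exists_steinEq_le_steinFactor hlam hQ hmean (b := b) (h := h)
    (c := 1 / 2 - c) (fun s => by rw [hbs]; change _ = ind s - 1 / 2 + (1 / 2 - c); ring)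
    ((BoundedContinuousFunction.norm_le (by norm_num)).2 hh1)
    ((BoundedContinuousFunction.norm_le zero_le_one).2 hb1) (by
      have h1 := heval hCm
      rw [hC, powerSum_compoundPoisson hQm hlam.le norm_shift_le, act_smul,
        BoundedContinuousFunction.smul_apply, smul_eq_mul] at h1
      have h2 : ∑' s, C s * ind s - c = 0 := sub_self c
      rw [h2] at h1
      exact (mul_eq_zero.1 h1).resolve_left (Real.exp_pos _).ne')
  refine ⟨b, F, hF, hFn, ?_⟩
  rw [heval hP, tvDist_eq hP hCm, ← (hsumI hP).tsum_sub (hsumI hCm)]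
  simp only [sub_mul, hind]

end TotalVariation

/-! ### The law of the sum, its size-biased versions and its derivative. -/

section BernoulliSums

lemma IsDistOnPos.isMass {Q : ℕ → ℝ} (hQ : IsDistOnPos Q) : IsMass Q := ⟨hQ.1, hQ.2.2⟩

lemma hasSum_bernoulliMass_smul {M : Type*} [AddCommGroup M] [Module ℝ M] [TopologicalSpace M]
    (p : ℝ) (f : ℕ → M) :
    HasSum (fun k => bernoulliMass p k • f k) ((1 - p) • f 0 + p • f 1) := by
  have h : ∑ k ∈ Finset.range 2, bernoulliMass p k • f k = (1 - p) • f 0 + p • f 1 := by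
    simp [Finset.sum_range_succ, bernoulliMass]
  rw [← h]
  refine hasSum_sum_of_ne_finset_zero fun k hk => ?_
  have : ¬ k < 2 := by simpa using hk
  simp [bernoulliMass, show k ≠ 0 by omega, show k ≠ 1 by omega]

lemma isMass_bernoulliMass {p : ℝ} (h0 : 0 ≤ p) (h1 : p < 1) : IsMass (bernoulliMass p) := by
  refine ⟨fun k => ?_, by simpa using hasSum_bernoulliMass_smul p fun _ => (1 : ℝ)⟩
  unfold bernoulliMass
  split_ifs <;> linarith

lemma mean_bernoulliMass (p : ℝ) : mean (bernoulliMass p) = p := by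
  have h := hasSum_bernoulliMass_smul p fun k => (k : ℝ)
  simp only [smul_eq_mul, Nat.cast_zero, mul_zero, Nat.cast_one, mul_one, zero_add] at h
  refine Eq.trans ?_ h.tsum_eq
  rw [mean]
  exact tsum_congr fun k => mul_comm _ _

lemma compound_bernoulliMass (Q : ℕ → ℝ) (p : ℝ) (s : ℕ) :
    compound Q (bernoulliMass p) s = (1 - p) * unitMass s + p * Q s := by
  have h := hasSum_bernoulliMass_smul p fun k => convMass (fun _ : Fin k => Q) s
  simp only [smul_eq_mul, convMass_const_zero, convMass_const_one] at h
  exact h.tsum_eq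

lemma sizeBias_bernoulliMass {p : ℝ} (hp : p ≠ 0) : sizeBias (bernoulliMass p) = unitMass := by
  funext k
  rw [sizeBias, mean_bernoulliMass]
  rcases k with _ | k
  · simp [bernoulliMass, unitMass, hp]
  · simp [bernoulliMass, unitMass]

lemma compound_unitMass (Q : ℕ → ℝ) : compound Q unitMass = unitMass := by
  funext s
  rw [compound, tsum_eq_single 0 fun k hk => by simp [unitMass, hk], convMass_const_zero]
  simp [unitMass]

lemma derivCoeff_compound_bernoulliMass (Q : ℕ → ℝ) (p : ℝ) :
    derivCoeff (compound Q (bernoulliMass p)) = fun j => p * derivCoeff Q j := by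
  funext j
  rw [derivCoeff, compound_bernoulliMass, derivCoeff]
  simp only [unitMass, Nat.add_eq_zero_iff, one_ne_zero, and_false, if_false]
  ring

lemma summable_derivCoeff {Q : ℕ → ℝ} (h : Summable fun j : ℕ => (j : ℝ) * Q j) :
    Summable (derivCoeff Q) := by
  refine ((summable_nat_add_iff 1).2 h).congr fun j => ?_
  simp [derivCoeff]

lemma tsum_derivCoeff {Q : ℕ → ℝ} (h : Summable fun j : ℕ => (j : ℝ) * Q j) :
    ∑' j, derivCoeff Q j = mean Q := by
  rw [mean, h.tsum_eq_zero_add]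
  simp [derivCoeff]

lemma one_le_mean {Q : ℕ → ℝ} (hQ : IsDistOnPos Q) (h : Summable fun j : ℕ => (j : ℝ) * Q j) :
    1 ≤ mean Q := by
  rw [← hQ.2.2.tsum_eq]
  refine hQ.2.2.summable.tsum_le_tsum (fun j => ?_) h
  rcases j with _ | j
  · simp [hQ.2.1]
  · refine le_mul_of_one_le_left (hQ.1 _) ?_
    push_cast
    have := Nat.cast_nonneg (α := ℝ) j
    linarith

lemma mean_compound_bernoulliMass (Q : ℕ → ℝ) (p : ℝ) :
    mean (compound Q (bernoulliMass p)) = p * mean Q := by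
  rw [mean, mean, ← tsum_mul_left]
  refine tsum_congr fun j => ?_
  rw [compound_bernoulliMass]
  rcases j with _ | j
  · simp
  · simp only [unitMass, Nat.add_eq_zero_iff, one_ne_zero, and_false, if_false]
    ring

variable {n : ℕ} {p : Fin n → ℝ} {Q : Fin n → ℕ → ℝ}

/-- The law of the sum of all but the `i`-th of the independent summands. -/
noncomputable def omitMass (p : Fin n → ℝ) (Q : Fin n → ℕ → ℝ) (i : Fin n) : ℕ → ℝ :=
  convMass (Function.update (fun j => compound (Q j) (bernoulliMass (p j))) i unitMass)

lemma weight_bernoulliMass (hQ : ∀ i, IsDistOnPos (Q i))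
    (hmean : ∀ i, Summable fun j : ℕ => (j : ℝ) * Q i j) (i : Fin n) :
    weight Q (fun i => bernoulliMass (p i)) i = p i := by
  rw [weight, mean_compound_bernoulliMass,
    mul_div_cancel_right₀ _ (zero_lt_one.trans_le (one_le_mean (hQ i) (hmean i))).ne']

/-- When p_i = 0 the size-biased mass is a division by zero, hence 0 rather than a unit mass; the
weight p_i hides the discrepancy. -/
lemma mul_sumMassBiased (i : Fin n) (s : ℕ) :
    p i * sumMassBiased Q (fun i => bernoulliMass (p i)) i s = p i * omitMass p Q i s := by
  rcases eq_or_ne (p i) 0 with h | h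
  · rw [h, zero_mul, zero_mul]
  · rw [sumMassBiased, sizeBias_bernoulliMass h, compound_unitMass, omitMass]

lemma isMass_summand (hp0 : ∀ i, 0 ≤ p i) (hp1 : ∀ i, p i < 1) (hQ : ∀ i, IsDistOnPos (Q i))
    (i : Fin n) : IsMass (compound (Q i) (bernoulliMass (p i))) :=
  isMass_compound (hQ i).isMass (isMass_bernoulliMass (hp0 i) (hp1 i))

lemma isMass_sumMass (hp0 : ∀ i, 0 ≤ p i) (hp1 : ∀ i, p i < 1) (hQ : ∀ i, IsDistOnPos (Q i)) :
    IsMass (sumMass Q fun i => bernoulliMass (p i)) :=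
  isMass_convMass (isMass_summand hp0 hp1 hQ)

lemma isMass_omitMass (hp0 : ∀ i, 0 ≤ p i) (hp1 : ∀ i, p i < 1) (hQ : ∀ i, IsDistOnPos (Q i))
    (i : Fin n) : IsMass (omitMass p Q i) := by
  refine isMass_convMass fun j => ?_
  rcases eq_or_ne j i with rfl | h
  · rw [Function.update_self]; exact isMass_unitMass
  · rw [Function.update_of_ne h]; exact isMass_summand hp0 hp1 hQ j

lemma mk_omitMass (i : Fin n) : PowerSeries.mk (omitMass p Q i) =
    ∏ j ∈ Finset.univ.erase i, PowerSeries.mk (compound (Q j) (bernoulliMass (p j))) := by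
  rw [omitMass, mk_convMass, ← Finset.mul_prod_erase _ _ (Finset.mem_univ i),
    Function.update_self, mk_unitMass, one_mul]
  refine Finset.prod_congr rfl fun j hj => ?_
  rw [Function.update_of_ne (Finset.ne_of_mem_erase hj)]

lemma sumMass_eq_convPair (i : Fin n) : sumMass Q (fun i => bernoulliMass (p i)) =
    convPair (compound (Q i) (bernoulliMass (p i))) (omitMass p Q i) :=
  mk_injective (by
    rw [mk_convPair, mk_omitMass, Finset.mul_prod_erase Finset.univ
      (fun j => PowerSeries.mk (compound (Q j) (bernoulliMass (p j)))) (Finset.mem_univ i)]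
    exact mk_convMass _)

/-- Only the event Y_i = 0, of probability 1 - p_i, is kept. As p_i < 1, the law omitting Y_i
vanishes wherever P does. -/
lemma mul_omitMass_le_sumMass (hp0 : ∀ i, 0 ≤ p i) (hp1 : ∀ i, p i < 1)
    (hQ : ∀ i, IsDistOnPos (Q i)) (i : Fin n) (s : ℕ) :
    (1 - p i) * omitMass p Q i s ≤ sumMass Q (fun i => bernoulliMass (p i)) s := by
  rw [sumMass_eq_convPair i, convPair]
  have h0 : compound (Q i) (bernoulliMass (p i)) 0 = 1 - p i := by
    rw [compound_bernoulliMass, (hQ i).2.1]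
    simp [unitMass]
  rw [← h0]
  have hg := (isMass_summand hp0 hp1 hQ i).1
  have hG := (isMass_omitMass hp0 hp1 hQ i).1
  generalize compound (Q i) (bernoulliMass (p i)) = g at hg ⊢
  generalize omitMass p Q i = G at hG ⊢
  have hmem : ((0, s) : ℕ × ℕ) ∈ Finset.HasAntidiagonal.antidiagonal s :=
    Finset.HasAntidiagonal.mem_antidiagonal.2 (zero_add s)
  exact Finset.single_le_sum (f := fun kl : ℕ × ℕ => g kl.1 * G kl.2)
    (fun kl _ => mul_nonneg (hg kl.1) (hG kl.2)) hmem

lemma derivation_prod {R A ι : Type*} [CommSemiring R] [CommRing A] [Algebra R A] [DecidableEq ι]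
    (D : Derivation R A A) (s : Finset ι) (f : ι → A) :
    D (∏ i ∈ s, f i) = ∑ i ∈ s, D (f i) * ∏ j ∈ s.erase i, f j := by
  induction s using Finset.induction_on with
  | empty => simp
  | insert i s hi ih =>
    rw [Finset.prod_insert hi, D.leibniz, ih, Finset.sum_insert hi, Finset.erase_insert hi,
      smul_eq_mul, smul_eq_mul, add_comm, mul_comm (∏ j ∈ s, f j), Finset.mul_sum]
    congr 1
    refine Finset.sum_congr rfl fun j hj => ?_
    have hij : i ≠ j := fun h => hi (h ▸ hj)
    rw [Finset.erase_insert_of_ne hij, Finset.prod_insert fun h => hi (Finset.mem_of_mem_erase h)]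
    ring

/-- Leibniz' rule for the generating function ∏ (1 - p_i + p_i Q_i(z)), whose i-th factor has
derivative p_i Q_i'(z). -/
lemma derivCoeff_sumMass : derivCoeff (sumMass Q fun i => bernoulliMass (p i)) =
    fun s => ∑ i, p i * convPair (derivCoeff (Q i)) (omitMass p Q i) s := by
  refine mk_injective ?_
  have h : PowerSeries.mk (sumMass Q fun i => bernoulliMass (p i)) =
      ∏ i, PowerSeries.mk (compound (Q i) (bernoulliMass (p i))) := mk_convMass _
  rw [mk_derivCoeff, h, derivation_prod]
  simp only [← mk_omitMass, ← mk_derivCoeff, ← mk_convPair]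
  ext s
  rw [map_sum, PowerSeries.coeff_mk]
  refine Finset.sum_congr rfl fun i _ => ?_
  rw [PowerSeries.coeff_mk, derivCoeff_compound_bernoulliMass, convPair, convPair, Finset.mul_sum]
  exact Finset.sum_congr rfl fun kl _ => mul_assoc _ _ _

end BernoulliSums

/-! ### The mixture and its mean. -/

section Mixture

variable {n : ℕ} {p : Fin n → ℝ} {Q : Fin n → ℕ → ℝ}

lemma isDistOnPos_mixture (hp0 : ∀ i, 0 ≤ p i) (hlam : 0 < ∑ i, p i)
    (hQ : ∀ i, IsDistOnPos (Q i)) : IsDistOnPos (mixture p Q) := by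
  refine ⟨fun j => Finset.sum_nonneg fun i _ =>
    mul_nonneg (div_nonneg (hp0 i) hlam.le) ((hQ i).1 j), ?_, ?_⟩
  · exact Finset.sum_eq_zero fun i _ => by rw [(hQ i).2.1, mul_zero]
  · have h := hasSum_sum fun i (_ : i ∈ Finset.univ) => (hQ i).2.2.mul_left (p i / ∑ k, p k)
    simp only [mul_one, ← Finset.sum_div, div_self hlam.ne'] at h
    exact h

lemma hasSum_mul_mixture (hmean : ∀ i, Summable fun j : ℕ => (j : ℝ) * Q i j) :
    HasSum (fun j : ℕ => (j : ℝ) * mixture p Q j) (mixtureMean p Q) := by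
  have h := hasSum_sum fun i (_ : i ∈ Finset.univ) =>
    (hmean i).hasSum.mul_left (p i / ∑ k, p k)
  convert! h using 1
  · funext j
    rw [mixture, Finset.mul_sum]
    exact Finset.sum_congr rfl fun i _ => by ring
  · rw [mixtureMean, Finset.sum_div]
    exact Finset.sum_congr rfl fun i _ => by rw [mean]; ring

lemma tsum_abs_derivCoeff_sub {Q Q' : ℕ → ℝ} (h : Summable fun j : ℕ => (j : ℝ) * Q j)
    (h' : Summable fun j : ℕ => (j : ℝ) * Q' j) :
    HasSum (fun j : ℕ => (j : ℝ) * |Q j - Q' j|) (∑' j, |derivCoeff Q j - derivCoeff Q' j|) := by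
  rw [← hasSum_nat_add_iff' 1]
  simp only [Finset.range_one, Finset.sum_singleton, Nat.cast_zero, zero_mul, sub_zero]
  convert! ((summable_derivCoeff h).sub (summable_derivCoeff h')).abs.hasSum using 1
  funext j
  rw [derivCoeff, derivCoeff, ← mul_sub, abs_mul,
    abs_of_nonneg (show (0 : ℝ) ≤ (j : ℝ) + 1 by positivity)]
  push_cast
  rfl

end Mixture

/-! ### Splitting the mean of the Stein operator. -/

section Expectation

variable {n : ℕ} {p : Fin n → ℝ} {Q : Fin n → ℕ → ℝ}

lemma powerSum_sum {A : Type*} [NormedCommRing A] [NormedAlgebra ℝ A] [CompleteSpace A]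
    [NormOneClass A] {ι : Type*} (s : Finset ι) (c : ι → ℝ) {a : ι → ℕ → ℝ}
    (ha : ∀ i, Summable (a i)) {x : A} (hx : ‖x‖ ≤ 1) :
    powerSum (fun j => ∑ i ∈ s, c i * a i j) x = ∑ i ∈ s, c i • powerSum (a i) x := by
  refine HasSum.tsum_eq ?_
  have h := hasSum_sum fun i (_ : i ∈ s) => (hasSum_powerSum (ha i) hx).const_smul (c i)
  simpa only [Finset.sum_smul, smul_smul] using h

lemma powerSum_const_mul {A : Type*} [NormedCommRing A] [NormedAlgebra ℝ A] [CompleteSpace A]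
    [NormOneClass A] (c : ℝ) {a : ℕ → ℝ} (ha : Summable a) {x : A} (hx : ‖x‖ ≤ 1) :
    powerSum (fun j => c * a j) x = c • powerSum a x := by
  refine HasSum.tsum_eq ?_
  simpa only [smul_smul] using (hasSum_powerSum ha hx).const_smul c

lemma IsMass.norm_powerSum_le_one {P : ℕ → ℝ} (hP : IsMass P) : ‖powerSum P shift‖ ≤ 1 := by
  refine (norm_powerSum_le hP.2.summable norm_shift_le).trans_eq ?_
  simp only [abs_of_nonneg (hP.1 _), hP.2.tsum_eq]

/-- The mean of the Stein operator under the law of the sum. -/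
lemma act_sumMass_le (hp0 : ∀ i, 0 ≤ p i) (hp1 : ∀ i, p i < 1) (hlam : 0 < ∑ i, p i)
    (hQ : ∀ i, IsDistOnPos (Q i)) (hmean : ∀ i, Summable fun j : ℕ => (j : ℝ) * Q i j)
    {b F : ℕ →ᵇ ℝ} (hF : SteinEq (fun j => (∑ i, p i) * mixture p Q j) b F) :
    act (powerSum (sumMass Q fun i => bernoulliMass (p i)) shift) b 0 ≤
      ‖F‖ * (mixtureMean p Q * (∑' s, |(∑ i, p i) * sumMass Q (fun i => bernoulliMass (p i)) s -
          ∑ i, p i * omitMass p Q i s|) +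
        ∑ i, p i * ∑' j, |derivCoeff (mixture p Q) j - derivCoeff (Q i) j|) := by
  set lam := ∑ i, p i
  set P := sumMass Q fun i => bernoulliMass (p i)
  set q := mixture p Q
  have hP : IsMass P := isMass_sumMass hp0 hp1 hQ
  have hG := isMass_omitMass hp0 hp1 hQ
  have hq := isDistOnPos_mixture hp0 hlam hQ
  have hqm : Summable fun j : ℕ => (j : ℝ) * q j := (hasSum_mul_mixture hmean).summable
  have hdq := summable_derivCoeff hqm
  have hdQ (i : Fin n) := summable_derivCoeff (hmean i)
  have hconv (i : Fin n) := summable_convPair (hdQ i) (hG i).2.summable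
  have hdP : Summable (derivCoeff P) := by
    rw [derivCoeff_sumMass]
    exact summable_sum fun i _ => (hconv i).mul_left _
  have hdP_eq : powerSum (derivCoeff P) shift =
      ∑ i, p i • (powerSum (derivCoeff (Q i)) shift * powerSum (omitMass p Q i) shift) := by
    rw [derivCoeff_sumMass, powerSum_sum _ _ hconv norm_shift_le]
    simp only [powerSum_convPair (hdQ _) (hG _).2.summable norm_shift_le]
  have hD : derivCoeff (fun j => lam * q j) = fun j => lam * derivCoeff q j := by
    funext j
    simp only [derivCoeff]
    ring
  have hder := isDer_shift.powerSum hP.2.summable hdP norm_shift_le F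
    (act (powerSum (derivCoeff fun j => lam * q j) shift) F - b) (fun k => by
      have := hF k
      rw [BoundedContinuousFunction.sub_apply]
      linarith) 0
  rw [Nat.cast_zero, zero_mul, zero_add, act_map_sub, BoundedContinuousFunction.sub_apply,
    ← act_mul, sub_eq_iff_eq_add, ← sub_eq_iff_eq_add', mul_one, hD,
    powerSum_const_mul _ hdq norm_shift_le, hdP_eq] at hder
  set U : ShiftAlg := powerSum (fun s => lam * P s - ∑ i, p i * omitMass p Q i s) shift with hU
  have hUs : Summable fun s => lam * P s - ∑ i, p i * omitMass p Q i s :=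
    (hP.2.summable.mul_left _).sub (summable_sum fun i _ => (hG i).2.summable.mul_left _)
  have hU_eq : U = lam • powerSum P shift - ∑ i, p i • powerSum (omitMass p Q i) shift := by
    rw [hU, powerSum_sub (hP.2.summable.mul_left _)
      (summable_sum fun i _ => (hG i).2.summable.mul_left _) norm_shift_le,
      powerSum_const_mul _ hP.2.summable norm_shift_le,
      powerSum_sum _ _ (fun i => (hG i).2.summable) norm_shift_le]
  set W : ShiftAlg := ∑ i, p i • (powerSum (fun j => derivCoeff q j - derivCoeff (Q i) j) shift *
    powerSum (omitMass p Q i) shift) with hW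
  -- The terms p_i q'(E) G_i(E) are subtracted and added back: U compares P with the laws omitting
  -- one summand, W compares the mixture with each Q_i.
  have hsplit : powerSum P shift * lam • powerSum (derivCoeff q) shift -
      ∑ i, p i • (powerSum (derivCoeff (Q i)) shift * powerSum (omitMass p Q i) shift) =
      powerSum (derivCoeff q) shift * U + W := by
    rw [hU_eq, hW, mul_sub, Finset.mul_sum, sub_add, ← Finset.sum_sub_distrib]
    congr 1
    · rw [mul_smul_comm, mul_smul_comm, mul_comm]
    · refine Finset.sum_congr rfl fun i _ => ?_
      rw [powerSum_sub hdq (hdQ i) norm_shift_le, mul_smul_comm, ← smul_sub, sub_mul,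
        sub_sub_cancel]
  have hval : act (powerSum P shift) b 0 = act (powerSum (derivCoeff q) shift * U + W) F 0 := by
    rw [← hder, ← BoundedContinuousFunction.sub_apply, ← act_sub, hsplit]
  rw [hval, mul_comm ‖F‖]
  refine (le_abs_self _).trans ((act_apply_le _ _ _).trans
    (mul_le_mul_of_nonneg_right ?_ (norm_nonneg _)))
  refine (norm_add_le _ _).trans (add_le_add ?_ ?_)
  · have h1 : ‖powerSum (derivCoeff q) shift‖ ≤ mixtureMean p Q := by
      refine (norm_powerSum_le hdq norm_shift_le).trans_eq ?_
      have hnn (j : ℕ) : 0 ≤ derivCoeff q j := mul_nonneg (by positivity) (hq.1 _)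
      simp only [abs_of_nonneg (hnn _), tsum_derivCoeff hqm]
      exact (hasSum_mul_mixture hmean).tsum_eq
    exact (norm_mul_le _ _).trans (mul_le_mul h1 (norm_powerSum_le hUs norm_shift_le)
      (norm_nonneg _) ((norm_nonneg _).trans h1))
  · refine (norm_sum_le _ _).trans (Finset.sum_le_sum fun i _ => ?_)
    rw [norm_smul, Real.norm_of_nonneg (hp0 i)]
    refine mul_le_mul_of_nonneg_left ?_ (hp0 i)
    refine (norm_mul_le _ _).trans ((mul_le_of_le_one_right (norm_nonneg _)
      (hG i).norm_powerSum_le_one).trans ?_)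
    exact norm_powerSum_le (hdq.sub (hdQ i)) norm_shift_le

end Expectation

/-! ### From random variables to mass functions. -/

section Law

variable {Ω : Type*} [MeasurableSpace Ω] {μ : Measure Ω} [IsProbabilityMeasure μ]

lemma ae_ne_of_measureReal_eq_zero {X : Ω → ℕ} {k : ℕ} (h : μ.real (X ⁻¹' {k}) = 0) :
    ∀ᵐ ω ∂μ, X ω ≠ k := by
  rw [ae_iff]
  simpa [measureReal_eq_zero_iff, Set.preimage] using h

lemma measureReal_bernoulli_mul {B X : Ω → ℕ} {p : ℝ} {Q : ℕ → ℝ} (hQ : IsDistOnPos Q)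
    (hB : ∀ k, μ.real (B ⁻¹' {k}) = bernoulliMass p k) (hX : ∀ k, μ.real (X ⁻¹' {k}) = Q k)
    (hBX : IndepFun B X μ) (k : ℕ) :
    μ.real ((fun ω => B ω * X ω) ⁻¹' {k}) = compound Q (bernoulliMass p) k := by
  have hB2 : ∀ᵐ ω ∂μ, B ω = 0 ∨ B ω = 1 := by
    have h : ∀ᵐ ω ∂μ, ∀ k, B ω ≠ k + 2 := ae_all_iff.2 fun k =>
      ae_ne_of_measureReal_eq_zero (by rw [hB]; simp [bernoulliMass])
    filter_upwards [h] with ω hω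
    by_contra! hcon
    exact hω (B ω - 2) (by omega)
  -- As Q lives on the positive integers, BX = 0 exactly when B = 0, up to a null set.
  have hX0 : ∀ᵐ ω ∂μ, X ω ≠ 0 := ae_ne_of_measureReal_eq_zero (by rw [hX, hQ.2.1])
  rw [compound_bernoulliMass]
  rcases eq_or_ne k 0 with rfl | hk
  · have h : (fun ω => B ω * X ω) ⁻¹' {0} =ᵐ[μ] B ⁻¹' {0} := by
      filter_upwards [hX0] with ω hω
      refine propext ?_
      change B ω * X ω = 0 ↔ B ω = 0
      simp [hω]
    rw [measureReal_congr h, hB, hQ.2.1]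
    simp [bernoulliMass, unitMass]
  · have h : (fun ω => B ω * X ω) ⁻¹' {k} =ᵐ[μ] (B ⁻¹' {1} ∩ X ⁻¹' {k} : Set Ω) := by
      filter_upwards [hB2] with ω hω
      refine propext ?_
      change B ω * X ω = k ↔ B ω = 1 ∧ X ω = k
      rcases hω with h | h
      · simp [h, hk.symm]
      · simp [h]
    rw [measureReal_congr h, measureReal_def,
      hBX.measure_inter_preimage_eq_mul _ _ (MeasurableSet.singleton 1)
        (MeasurableSet.singleton k), ENNReal.toReal_mul, ← measureReal_def, ← measureReal_def,
      hB, hX]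
    simp [bernoulliMass, unitMass, hk]

lemma measureReal_sum_eq_convMass {ι : Type*} [Fintype ι] [DecidableEq ι] {Y : ι → Ω → ℕ}
    {f : ι → ℕ → ℝ} (hY : ∀ i, Measurable (Y i)) (hf : ∀ i k, μ.real (Y i ⁻¹' {k}) = f i k)
    (hind : iIndepFun Y μ) (s : ℕ) :
    μ.real ((fun ω => ∑ i, Y i ω) ⁻¹' {s}) = convMass f s := by
  have hset : (fun ω => ∑ i, Y i ω) ⁻¹' {s} =
      ⋃ x ∈ Finset.piAntidiag Finset.univ s, ⋂ i, Y i ⁻¹' {x i} := by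
    ext ω
    simp only [Set.mem_preimage, Set.mem_singleton_iff, Set.mem_iUnion, Set.mem_iInter,
      Finset.mem_piAntidiag]
    constructor
    · intro h
      exact ⟨fun i => Y i ω, ⟨h, fun i _ => Finset.mem_univ i⟩, fun i => rfl⟩
    · rintro ⟨x, ⟨hx, -⟩, hY⟩
      simpa only [hY] using hx
  have hmeas (x : ι → ℕ) : MeasurableSet (⋂ i, Y i ⁻¹' {x i}) :=
    MeasurableSet.iInter fun i => hY i (MeasurableSet.singleton _)
  rw [hset, measureReal_biUnion_finset ?_ fun x _ => hmeas x, convMass]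
  · refine Finset.sum_congr rfl fun x _ => ?_
    rw [measureReal_def, hind.meas_iInter fun i => ⟨{x i}, MeasurableSet.singleton _, rfl⟩,
      ENNReal.toReal_prod]
    exact Finset.prod_congr rfl fun i _ => hf i (x i)
  · intro x _ y _ hxy
    refine Set.disjoint_left.2 fun ω hx hy => hxy (funext fun i => ?_)
    have h1 : Y i ω = x i := Set.mem_iInter.1 hx i
    have h2 : Y i ω = y i := Set.mem_iInter.1 hy i
    exact h1.symm.trans h2

end Law

/-! ### Size-biased information, dissimilarity and the final bound. -/

section Bound

variable {n : ℕ} {p : Fin n → ℝ} {Q : Fin n → ℕ → ℝ}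

/-- Where P(s) = 0 the score is a default value, but every omitting law vanishes there too, so both
sides are 0. -/
lemma mul_abs_score (hp0 : ∀ i, 0 ≤ p i) (hp1 : ∀ i, p i < 1) (hlam : 0 < ∑ i, p i)
    (hQ : ∀ i, IsDistOnPos (Q i)) (hmean : ∀ i, Summable fun j : ℕ => (j : ℝ) * Q i j) (s : ℕ) :
    |(∑ i, p i) * sumMass Q (fun i => bernoulliMass (p i)) s - ∑ i, p i * omitMass p Q i s| =
      (∑ i, p i) * (sumMass Q (fun i => bernoulliMass (p i)) s *
        |score Q (fun i => bernoulliMass (p i)) s|) := by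
  have hP := (isMass_sumMass hp0 hp1 hQ).1 s
  simp only [score, weight_bernoulliMass hQ hmean, mul_sumMassBiased]
  rcases hP.eq_or_lt with h0 | h0
  · have hG (i : Fin n) : omitMass p Q i s = 0 := by
      have h1 := mul_omitMass_le_sumMass hp0 hp1 hQ i s
      rw [← h0] at h1
      have h2 := (isMass_omitMass hp0 hp1 hQ i).1 s
      nlinarith [hp1 i]
    simp [← h0, hG]
  · rw [← mul_assoc, ← abs_of_pos (mul_pos hlam h0), ← abs_mul, abs_of_pos (mul_pos hlam h0),
      mul_sub, mul_div_cancel₀ _ (mul_pos hlam h0).ne', mul_one, abs_sub_comm]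

/-- The Cauchy–Schwarz inequality for the first absolute moment under a mass function. -/
lemma tsum_ofReal_mul_abs_le {P r : ℕ → ℝ} (hP : IsMass P) :
    ∑' s, ENNReal.ofReal (P s * |r s|) ≤
      (∑' s, ENNReal.ofReal (P s * r s ^ 2)) ^ (1 / 2 : ℝ) := by
  have h := ENNReal.lintegral_mul_le_Lp_mul_Lq (Measure.count : Measure ℕ)
    (Real.HolderConjugate.two_two) (f := fun s => ENNReal.ofReal (√(P s)))
    (g := fun s => ENNReal.ofReal (√(P s) * |r s|))
    (measurable_of_countable _).aemeasurable (measurable_of_countable _).aemeasurable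
  simp only [lintegral_count, Pi.mul_apply] at h
  have h1 (s : ℕ) : ENNReal.ofReal (√(P s)) ^ (2 : ℝ) = ENNReal.ofReal (P s) := by
    rw [ENNReal.ofReal_rpow_of_nonneg (Real.sqrt_nonneg _) zero_le_two, Real.rpow_two,
      Real.sq_sqrt (hP.1 s)]
  have h2 (s : ℕ) : ENNReal.ofReal (√(P s) * |r s|) ^ (2 : ℝ) =
      ENNReal.ofReal (P s * r s ^ 2) := by
    rw [ENNReal.ofReal_rpow_of_nonneg (by positivity) zero_le_two, Real.rpow_two, mul_pow,
      Real.sq_sqrt (hP.1 s), sq_abs]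
  have h3 (s : ℕ) : ENNReal.ofReal (√(P s)) * ENNReal.ofReal (√(P s) * |r s|) =
      ENNReal.ofReal (P s * |r s|) := by
    rw [← ENNReal.ofReal_mul (Real.sqrt_nonneg _), ← mul_assoc, Real.mul_self_sqrt (hP.1 s)]
  simp only [h1, h2, h3] at h
  rwa [← ENNReal.ofReal_tsum_of_nonneg hP.1 hP.2.summable, hP.2.tsum_eq, ENNReal.ofReal_one,
    ENNReal.one_rpow, one_mul] at h

/-- The left side is λ E|r₁| ≤ (λ² E r₁²)^(1/2); one λ is the explicit prefactor on the right, the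
other sits inside J. -/
lemma ofReal_tsum_le_sizeBiasedInfo (hp0 : ∀ i, 0 ≤ p i) (hp1 : ∀ i, p i < 1)
    (hlam : 0 < ∑ i, p i) (hQ : ∀ i, IsDistOnPos (Q i))
    (hmean : ∀ i, Summable fun j : ℕ => (j : ℝ) * Q i j) :
    ENNReal.ofReal (∑' s, |(∑ i, p i) * sumMass Q (fun i => bernoulliMass (p i)) s -
        ∑ i, p i * omitMass p Q i s|) ≤
      (ENNReal.ofReal (∑ i, p i) *
        sizeBiasedInfo Q (fun i => bernoulliMass (p i))) ^ (1 / 2 : ℝ) := by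
  have hP := isMass_sumMass hp0 hp1 hQ
  have hs : Summable fun s => |(∑ i, p i) * sumMass Q (fun i => bernoulliMass (p i)) s -
      ∑ i, p i * omitMass p Q i s| :=
    ((hP.2.summable.mul_left _).sub
      (summable_sum fun i _ => (isMass_omitMass hp0 hp1 hQ i).2.summable.mul_left _)).abs
  rw [ENNReal.ofReal_tsum_of_nonneg (fun _ => abs_nonneg _) hs]
  simp only [mul_abs_score hp0 hp1 hlam hQ hmean, ENNReal.ofReal_mul hlam.le]
  rw [ENNReal.tsum_mul_left, sizeBiasedInfo]
  simp only [weight_bernoulliMass hQ hmean]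
  rw [← mul_assoc, ENNReal.mul_rpow_of_nonneg _ _ (by norm_num), ← pow_two,
    ← ENNReal.rpow_natCast, ← ENNReal.rpow_mul]
  norm_num only [Nat.cast_ofNat, ENNReal.rpow_one]
  have h := tsum_ofReal_mul_abs_le (r := score Q fun i => bernoulliMass (p i)) hP
  exact mul_le_mul_right h _

lemma mixtureMean_pos (hp0 : ∀ i, 0 ≤ p i) (hlam : 0 < ∑ i, p i) (hQ : ∀ i, IsDistOnPos (Q i))
    (hmean : ∀ i, Summable fun j : ℕ => (j : ℝ) * Q i j) : 0 < mixtureMean p Q := by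
  have h := one_le_mean (isDistOnPos_mixture hp0 hlam hQ) (hasSum_mul_mixture hmean).summable
  rw [mean, (hasSum_mul_mixture hmean).tsum_eq] at h
  linarith

/-- Finite means make the double series converge, so D is a real number and the last step can be
done in ℝ. -/
lemma dissimilarity_eq (hp0 : ∀ i, 0 ≤ p i) (hlam : 0 < ∑ i, p i)
    (hQ : ∀ i, IsDistOnPos (Q i)) (hmean : ∀ i, Summable fun j : ℕ => (j : ℝ) * Q i j) :
    dissimilarity p Q = ENNReal.ofReal
      ((∑ i, p i * ∑' j, |derivCoeff (mixture p Q) j - derivCoeff (Q i) j|) /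
        mixtureMean p Q) := by
  have hq := mixtureMean_pos hp0 hlam hQ hmean
  have h := hasSum_sum fun i (_ : i ∈ Finset.univ) =>
    (tsum_abs_derivCoeff_sub (hasSum_mul_mixture (p := p) hmean).summable
      (hmean i)).mul_left (p i / mixtureMean p Q)
  have h1 : ∑ i, p i / mixtureMean p Q *
      (∑' j, |derivCoeff (mixture p Q) j - derivCoeff (Q i) j|) =
      (∑ i, p i * ∑' j, |derivCoeff (mixture p Q) j - derivCoeff (Q i) j|) /
        mixtureMean p Q := by
    rw [Finset.sum_div]
    exact Finset.sum_congr rfl fun i _ => by ring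
  have h2 (j : ℕ) : ∑ i, (j : ℝ) * p i / mixtureMean p Q * |Q i j - mixture p Q j| =
      ∑ i, p i / mixtureMean p Q * ((j : ℝ) * |mixture p Q j - Q i j|) :=
    Finset.sum_congr rfl fun i _ => by rw [abs_sub_comm]; ring
  rw [dissimilarity, ← h1, ← h.tsum_eq, ENNReal.ofReal_tsum_of_nonneg ?_ h.summable]
  · simp only [h2]
  · exact fun j => Finset.sum_nonneg fun i _ =>
      mul_nonneg (div_nonneg (hp0 i) hq.le) (by positivity)

theorem tvDist_sumMass_le (hp0 : ∀ i, 0 ≤ p i) (hp1 : ∀ i, p i < 1) (hlam : 0 < ∑ i, p i)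
    (hQ : ∀ i, IsDistOnPos (Q i)) (hmean : ∀ i, Summable fun j : ℕ => (j : ℝ) * Q i j) :
    ENNReal.ofReal (tvDist (sumMass Q fun i => bernoulliMass (p i))
        (compoundPoisson (∑ i, p i) (mixture p Q))) ≤
      ENNReal.ofReal (steinFactor (∑ i, p i) (mixture p Q) * mixtureMean p Q) *
        ((ENNReal.ofReal (∑ i, p i) *
          sizeBiasedInfo Q (fun i => bernoulliMass (p i))) ^ (1 / 2 : ℝ) +
          dissimilarity p Q) := by
  have hq := mixtureMean_pos hp0 hlam hQ hmean
  obtain ⟨b, F, hF, hFn, htv⟩ := exists_tvDist_eq hlam (isDistOnPos_mixture hp0 hlam hQ)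
    (hasSum_mul_mixture hmean).summable (isMass_sumMass hp0 hp1 hQ)
  rw [htv, dissimilarity_eq hp0 hlam hQ hmean]
  refine le_trans ?_ (mul_le_mul_right (add_le_add_left
    (ofReal_tsum_le_sizeBiasedInfo hp0 hp1 hlam hQ hmean) _) _)
  have hle := act_sumMass_le hp0 hp1 hlam hQ hmean hF
  set U := ∑' s, |(∑ i, p i) * sumMass Q (fun i => bernoulliMass (p i)) s -
        ∑ i, p i * omitMass p Q i s|
  set W := ∑ i, p i * ∑' j, |derivCoeff (mixture p Q) j - derivCoeff (Q i) j|
  have hU : 0 ≤ U := tsum_nonneg fun _ => abs_nonneg _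
  have hW : 0 ≤ W := Finset.sum_nonneg fun i _ =>
    mul_nonneg (hp0 i) (tsum_nonneg fun _ => abs_nonneg _)
  have hH := (norm_nonneg F).trans hFn
  rw [← ENNReal.ofReal_add hU (by positivity), ← ENNReal.ofReal_mul (by positivity)]
  refine ENNReal.ofReal_le_ofReal (hle.trans ?_)
  refine (mul_le_mul_of_nonneg_right hFn (by positivity)).trans_eq ?_
  field_simp

end Bound

end CompoundPoisson

theorem mainTheorem4
    {Ω : Type*} [MeasurableSpace Ω] (μ : Measure Ω) [IsProbabilityMeasure μ]
    (n : ℕ) (p : Fin n → ℝ) (Q : Fin n → ℕ → ℝ) (B X : Fin n → Ω → ℕ)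
    (hp_nonneg : ∀ i, 0 ≤ p i) (hp_lt : ∀ i, p i < 1) (hlam : 0 < ∑ i, p i)
    (hQ : ∀ i, CompoundPoisson.IsDistOnPos (Q i))
    (hQ_mean : ∀ i, Summable fun j : ℕ => (j : ℝ) * Q i j)
    (hB_meas : ∀ i, Measurable (B i)) (hX_meas : ∀ i, Measurable (X i))
    (hB_law : ∀ i k, μ.real (B i ⁻¹' {k}) = CompoundPoisson.bernoulliMass (p i) k)
    (hX_law : ∀ i k, μ.real (X i ⁻¹' {k}) = Q i k)
    (hBX_indep : ∀ i, IndepFun (B i) (X i) μ)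
    (hY_indep : iIndepFun (fun i ω => B i ω * X i ω) μ) :
    ENNReal.ofReal (CompoundPoisson.tvDist
        (fun s => μ.real ((fun ω => ∑ i, B i ω * X i ω) ⁻¹' {s}))
        (CompoundPoisson.compoundPoisson (∑ i, p i) (CompoundPoisson.mixture p Q))) ≤
      ENNReal.ofReal (CompoundPoisson.steinFactor (∑ i, p i) (CompoundPoisson.mixture p Q)
          * CompoundPoisson.mixtureMean p Q) *
        ((ENNReal.ofReal (∑ i, p i) *
            CompoundPoisson.sizeBiasedInfo Q (fun i => CompoundPoisson.bernoulliMass (p i)))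
              ^ (1 / 2 : ℝ)
          + CompoundPoisson.dissimilarity p Q) := by
  have hY_meas (i : Fin n) : Measurable fun ω => B i ω * X i ω := (hB_meas i).mul (hX_meas i)
  have hlaw : (fun s => μ.real ((fun ω => ∑ i, B i ω * X i ω) ⁻¹' {s})) =
      CompoundPoisson.sumMass Q fun i => CompoundPoisson.bernoulliMass (p i) :=
    funext fun s => CompoundPoisson.measureReal_sum_eq_convMass hY_meas
      (fun i => CompoundPoisson.measureReal_bernoulli_mul (hQ i) (hB_law i) (hX_law i)
        (hBX_indep i)) hY_indep s
  rw [hlaw]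
  exact CompoundPoisson.tvDist_sumMass_le hp_nonneg hp_lt hlam hQ hQ_mean
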